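/- Let $\mathbb D=\{z\in\mathbb C:|z|<1\}$, let $\mathcal A$ be the class of analytic functions $f$ on $\mathbb D$ with $f(0)=0$, $f'(0)=1$, and let $\mathcal S\subset\mathcal A$ be the subclass of univalent functions. For analytic $g,\varphi$ on $\mathbb D$ write $g\prec\varphi$ if $g=\varphi\circ w$ for some analytic $w:\mathbb D\to\mathbb D$ with $w(0)=0$. Let $\mathcal S^*(\varphi)$ be the class of $f\in\mathcal S$ with $zf'(z)/f(z)\prec\varphi(z)$ (the quotient being assigned the value $1$ at $z=0$). Put $\mathcal S^*_{car}=\mathcal S^*(1+z+z^2/2)$; $\mathcal S^*[A,B]=\mathcal S^*\big((1+Az)/(1+Bz)\big)$ for $-1\le B<A\le 1$; $\mathcal S^*(\alpha)=\mathcal S^*[1-2\alpha,-1]$, $\mathcal S^*_e(\alpha)=\mathcal S^*(\alpha+(1-\alpha)e^z)$ and $\mathcal S^*_L(\alpha)=\mathcal S^*(\alpha+(1-\alpha)\sqrt{1+z})$ for $0\le\alpha<1$; $\mathcal{SS}^*(\beta)=\mathcal S^*\big(((1+z)/(1-z))^\beta\big)$ for $0<\beta\le1$; $\mathcal S^*(\sqrt{1+cz})$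 for $0<c\le 1$ (principal branches throughout); and, for $k\ge0$, let $k\text{-}\mathcal S^*$ be the class of $f\in\mathcal A$ with $\operatorname{Re}\big(zf'(z)/f(z)\big)>k\,\big|zf'(z)/f(z)-1\big|$ for all $z\in\mathbb D$. Then: (i) $\mathcal S^*_{car}\subset\mathcal S^*(\alpha)$ for $0\le\alpha\le 1/4$; (ii) $\mathcal S^*_{car}\subset\mathcal{SS}^*(\beta)$ for $\beta_0\le\beta\le1$, where $\beta_0=\frac{2}{\pi}\arctan\big(3\sqrt{3/5}\big)$; (iii) $k\text{-}\mathcal S^*\subset\mathcal S^*_{car}$ for $k\ge 5/3$; (iv) $\mathcal S^*_e(\alpha)\subset\mathcal S^*_{car}$ for $\alpha_0\le\alpha<1$, where $\alpha_0=\frac{e-2}{2(e-1)}$; (v) $\mathcal S^*_L(\alpha)\subset\mathcal S^*_{car}$ for $1/2\le\alpha<1$; (vi) $\mathcal S^*(\sqrt{1+cz})\subset\mathcal S^*_{car}$ for $0<c\le 3/4$; (vii) for $-1<B<A\le 1$, $\mathcal S^*[A,B]\subset\mathcal S^*_{car}$ if one of the following holds: (a) $1-B^2<2(1-AB)\le 3(1-B^2)$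 and $2A\le 1+B$; (b) $3(1-B^2)\le 2(1-AB)<5(1-B^2)$ and $2A\le 3+5B$; (viii) $\mathcal S^*_{car}\subset\mathcal S^*[1,-(M-1)/M]$ for $M\ge (3+\sqrt5)/4$. The constants in (i)–(vi) and (viii) are best possible: the stated inclusion fails in (i) for $1/4<\alpha<1$, in (ii) for $0<\beta<\beta_0$, in (iii) for $0\le k<5/3$, in (iv) for $0\le\alpha<\alpha_0$, in (v) for $0\le\alpha<1/2$, in (vi) for $3/4<c\le1$, and in (viii) for $1/2<M<(3+\sqrt5)/4$. -/

import Mathlib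

namespace CardioidStarlike

/-- The open unit disk of the complex plane. -/
abbrev disk : Set ℂ := Metric.ball (0 : ℂ) 1

/-- The class `𝒜` of analytic functions on the unit disk with `f(0) = 0` and `f'(0) = 1`.
Functions are total on `ℂ`; only their values on the disk matter. -/
def classA : Set (ℂ → ℂ) :=
  {f | AnalyticOnNhd ℂ f disk ∧ f 0 = 0 ∧ deriv f 0 = 1}

/-- The class `𝒮` of univalent functions in `𝒜`. -/
def classS : Set (ℂ → ℂ) :=
  {f | f ∈ classA ∧ Set.InjOn f disk}

/-- The function `z f'(z) / f(z)`, with its removable singularity at the origin filled in by the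
limit `1` (for `f ∈ 𝒜`). -/
noncomputable def starQuotient (f : ℂ → ℂ) (z : ℂ) : ℂ :=
  if z = 0 then 1 else z * deriv f z / f z

/-- Subordination `g ≺ φ` on the unit disk: `g = φ ∘ w` for a Schwarz function `w`. -/
def Subordinate (g φ : ℂ → ℂ) : Prop :=
  ∃ w : ℂ → ℂ, AnalyticOnNhd ℂ w disk ∧ w 0 = 0 ∧ Set.MapsTo w disk disk ∧
    ∀ z ∈ disk, g z = φ (w z)

/-- The Ma–Minda class `𝒮*(φ)`: univalent normalized `f` with `z f'/f ≺ φ`. -/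
def starlikeClass (φ : ℂ → ℂ) : Set (ℂ → ℂ) :=
  {f | f ∈ classS ∧ Subordinate (starQuotient f) φ}

/-- The class `𝒮*_car`, given by `φ(z) = 1 + z + z²/2`. -/
noncomputable def starCar : Set (ℂ → ℂ) :=
  starlikeClass fun z => 1 + z + z ^ 2 / 2

/-- The Janowski class `𝒮*[A, B]`. -/
noncomputable def janowski (A B : ℝ) : Set (ℂ → ℂ) :=
  starlikeClass fun z => (1 + (A : ℂ) * z) / (1 + (B : ℂ) * z)

/-- The class `𝒮*(α) = 𝒮*[1 - 2α, -1]` of starlike functions of order `α`. -/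
noncomputable def starlikeOfOrder (α : ℝ) : Set (ℂ → ℂ) :=
  janowski (1 - 2 * α) (-1)

/-- The class `𝒮𝒮*(β)` of strongly starlike functions of order `β` (principal power). -/
noncomputable def stronglyStarlike (β : ℝ) : Set (ℂ → ℂ) :=
  starlikeClass fun z => ((1 + z) / (1 - z)) ^ (β : ℂ)

/-- The class `k-𝒮*` of `k`-starlike functions: `Re (z f'/f) > k |z f'/f - 1|` on the disk.
For `k ≥ 0` the condition excludes zeros of `f` in the punctured disk, since division by zero
gives the value `0`, for which the strict inequality fails. -/
def kStarlike (k : ℝ) : Set (ℂ → ℂ) :=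
  {f | f ∈ classA ∧ ∀ z ∈ disk, k * ‖starQuotient f z - 1‖ < (starQuotient f z).re}

/-- The class `𝒮*_e(α)`, given by `φ(z) = α + (1 - α) eᶻ`. -/
noncomputable def starExp (α : ℝ) : Set (ℂ → ℂ) :=
  starlikeClass fun z => (α : ℂ) + (1 - (α : ℂ)) * Complex.exp z

/-- The class `𝒮*_L(α)`, given by `φ(z) = α + (1 - α) √(1 + z)` (principal root). -/
noncomputable def starLemniscate (α : ℝ) : Set (ℂ → ℂ) :=
  starlikeClass fun z => (α : ℂ) + (1 - (α : ℂ)) * (1 + z) ^ (1 / 2 : ℂ)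

/-- The class `𝒮*(√(1 + cz))` (principal root). -/
noncomputable def starCassini (c : ℝ) : Set (ℂ → ℂ) :=
  starlikeClass fun z => (1 + (c : ℂ) * z) ^ (1 / 2 : ℂ)

end CardioidStarlike

/-! The theorem reduces to containments between plane regions. Since `2(1 + w + w²/2) - 1 = (1 +
w)²`, subordination to this function means that `v = 2zf'/f - 1` stays in the square of the disk `|s
- 1| < 1`, a cardioid with cusp `0` and vertex `4`. The principal root inverts the square and
supplies the Schwarz function (`subordinate_car`); Möbius maps and powers are inverted likewise in
`subordinate_janowski` and `subordinate_strong`.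

For (i), (ii), (viii) the cardioid lies in a half-plane, a sector or a disk touching its boundary.
For (iii)–(vii) the other region lies in the cardioid; the sharp cases touch at the vertex in (iii)
and at the cusp in (iv)–(vi).

Sharpness uses a converse: any analytic `p` with `p(0) = 1` and `Re p > 0` is `zf'/f` for a
univalent `f`. Taking `p = φ` turns an inclusion of classes back into a condition on values, which
is contradicted at or near the touching point. For (iii) no explicit `φ` is used: `exists_lens` maps
the disk into a thin neighbourhood of a real segment. -/

namespace CardioidStarlike

/-! ### Univalence, and recovering `f` from `z f' / f`. -/

/-- A holomorphic function on a convex set whose derivative has positive real part is injective. -/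
theorem injOn_of_deriv_re_pos {U : Set ℂ} (hU : Convex ℝ U) {G G' : ℂ → ℂ}
    (hG : ∀ z ∈ U, HasDerivAt G (G' z) z) (hpos : ∀ z ∈ U, 0 < (G' z).re) : Set.InjOn G U := by
  intro a ha b hb hab
  by_contra hne
  have hd : b - a ≠ 0 := sub_ne_zero.mpr (Ne.symm hne)
  have hmem : ∀ t ∈ Set.Icc (0 : ℝ) 1, a + (t : ℂ) * (b - a) ∈ U := by
    intro t ht
    simpa using hU.add_smul_sub_mem ha hb ht
  -- Dividing by `b - a` cancels the chain-rule factor, so the derivative along the segment is `Re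
  -- G'` itself.
  have hder : ∀ t ∈ Set.Icc (0 : ℝ) 1, HasDerivAt
      (fun t : ℝ => (G (a + (t : ℂ) * (b - a)) / (b - a)).re)
      (G' (a + (t : ℂ) * (b - a))).re t := by
    intro t ht
    have h1 : HasDerivAt (fun s : ℂ => a + s * (b - a)) (b - a) (t : ℂ) := by
      simpa using ((hasDerivAt_id (t : ℂ)).mul_const (b - a)).const_add a
    have h2 := ((hG _ (hmem t ht)).comp (t : ℂ) h1).div_const (b - a)
    rw [mul_div_cancel_right₀ _ hd] at h2
    exact h2.real_of_complex
  have hmono : StrictMonoOn (fun t : ℝ => (G (a + (t : ℂ) * (b - a)) / (b - a)).re)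
      (Set.Icc 0 1) := by
    refine strictMonoOn_of_deriv_pos (convex_Icc 0 1)
      (fun t ht => (hder t ht).continuousAt.continuousWithinAt) fun t ht => ?_
    have ht' := interior_subset ht
    rw [(hder t ht').deriv]
    exact hpos _ (hmem t ht')
  have := hmono (Set.left_mem_Icc.mpr zero_le_one) (Set.right_mem_Icc.mpr zero_le_one) zero_lt_one
  simp [hab] at this

theorem starQuotient_eq_of_eqOn {f h h' : ℂ → ℂ} (hh : ∀ z ∈ disk, HasDerivAt h (h' z) z)
    (hf : ∀ z ∈ disk, f z = z * Complex.exp (h z)) {z : ℂ} (hz : z ∈ disk) :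
    starQuotient f z = 1 + z * h' z := by
  unfold starQuotient
  split_ifs with h0
  · simp [h0]
  · have hev : f =ᶠ[nhds z] fun z => z * Complex.exp (h z) := by
      filter_upwards [Metric.isOpen_ball.mem_nhds hz] with y hy using hf y hy
    have hd := (hasDerivAt_id z).mul (hh z hz).cexp
    have : deriv f z = 1 * Complex.exp (h z) + z * (Complex.exp (h z) * h' z) := by
      rw [hev.deriv_eq]; exact hd.deriv
    rw [this, hf z hz]
    have := Complex.exp_ne_zero (h z)
    field_simp

/-- If `Re (1 + z h') > 0` on the disk then `z exp h` is univalent there. -/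
theorem injOn_mul_exp {h h' : ℂ → ℂ} (hh : ∀ z ∈ disk, HasDerivAt h (h' z) z)
    (hpos : ∀ z ∈ disk, 0 < (1 + z * h' z).re) :
    Set.InjOn (fun z => z * Complex.exp (h z)) disk := by
  have hexp : ∀ s : ℂ, s.re < 0 → Complex.exp s ∈ disk := by
    intro s hs
    simpa [Complex.norm_exp] using hs
  -- Under `z = exp s` the left half-plane covers the punctured disk, and `s + h (exp s)` is a
  -- logarithm of `z exp (h z)` with derivative `1 + z h'`.
  have hinj : Set.InjOn (fun s => s + h (Complex.exp s)) {s : ℂ | s.re < 0} := by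
    refine injOn_of_deriv_re_pos (G' := fun s => 1 + Complex.exp s * h' (Complex.exp s))
      (convex_halfSpace_re_lt 0) (fun s hs => ?_) fun s hs => hpos _ (hexp s hs)
    have h2 := (hh _ (hexp s hs)).comp s (Complex.hasDerivAt_exp s)
    rw [mul_comm]
    exact (hasDerivAt_id s).add h2
  have hlog : ∀ z ∈ disk, z ≠ 0 → (Complex.log z).re < 0 := by
    intro z hz h0
    rw [Complex.log_re]
    exact Real.log_neg (norm_pos_iff.mpr h0) (by simpa using hz)
  intro a ha b hb hab
  simp only at hab
  by_cases ha0 : a = 0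
  · rw [ha0, zero_mul, zero_eq_mul] at hab
    rw [ha0, hab.resolve_right (Complex.exp_ne_zero _)]
  by_cases hb0 : b = 0
  · rw [hb0, zero_mul, mul_eq_zero] at hab
    rw [hb0, hab.resolve_right (Complex.exp_ne_zero _)]
  have key : Complex.exp (Complex.log a + h a) = Complex.exp (Complex.log b + h b) := by
    rw [Complex.exp_add, Complex.exp_add, Complex.exp_log ha0, Complex.exp_log hb0, hab]
  obtain ⟨n, hn⟩ := Complex.exp_eq_exp_iff_exists_int.mp key
  have hb' : Complex.exp (Complex.log b + n * (2 * Real.pi * Complex.I)) = b := by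
    rw [Complex.exp_add, Complex.exp_log hb0, Complex.exp_int_mul_two_pi_mul_I, mul_one]
  have heq : Complex.log a = Complex.log b + n * (2 * Real.pi * Complex.I) := by
    refine hinj (hlog a ha ha0) ?_ ?_
    · simpa using hlog b hb hb0
    · simp only [hb', Complex.exp_log ha0]
      rw [hn]; ring
  rw [← Complex.exp_log ha0, heq, hb']

/-- A normalized function without zeros in the punctured disk has the form `z exp h`. -/
theorem exists_eq_mul_exp {f : ℂ → ℂ} (hf : f ∈ classA) (h0 : ∀ z ∈ disk, z ≠ 0 → f z ≠ 0) :
    ∃ h h' : ℂ → ℂ, DifferentiableOn ℂ h' disk ∧ (∀ z ∈ disk, HasDerivAt h (h' z) z) ∧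
      ∀ z ∈ disk, f z = z * Complex.exp (h z) := by
  obtain ⟨hfa, hf0, hf1⟩ := hf
  have hq : DifferentiableOn ℂ (dslope f 0) disk :=
    (Complex.differentiableOn_dslope (Metric.ball_mem_nhds 0 one_pos)).mpr hfa.differentiableOn
  have hfq : ∀ z, f z = z * dslope f 0 z := by
    intro z
    have := sub_smul_dslope f 0 z
    simpa [hf0] using this.symm
  have hq0 : ∀ z ∈ disk, dslope f 0 z ≠ 0 := by
    intro z hz hc
    by_cases hz0 : z = 0
    · rw [hz0, dslope_same, hf1] at hc
      exact one_ne_zero hc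
    · exact h0 z hz hz0 (by rw [hfq, hc, mul_zero])
  have hq' : DifferentiableOn ℂ (deriv (dslope f 0)) disk := hq.deriv Metric.isOpen_ball
  have hd := hq'.div hq hq0
  -- `h` is the logarithm of `f(z)/z` vanishing at `0`, obtained as a primitive of its logarithmic
  -- derivative.
  obtain ⟨h, hh0, hh⟩ := hd.isExactOn_ball.with_val_at 0 0
  refine ⟨h, _, hd, hh, fun z hz => ?_⟩
  have hder : ∀ z ∈ disk, HasDerivAt (fun z => dslope f 0 z * Complex.exp (-h z)) 0 z := by
    intro z hz
    have h1 := ((hq.differentiableAt (Metric.isOpen_ball.mem_nhds hz)).hasDerivAt).mul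
      ((hh z hz).neg.cexp)
    refine h1.congr_deriv ?_
    have := hq0 z hz
    simp only [Pi.div_apply, Pi.neg_apply]
    field_simp
    ring
  have hconst := (convex_ball (0 : ℂ) 1).is_const_of_fderivWithin_eq_zero (𝕜 := ℂ)
    (f := fun z => dslope f 0 z * Complex.exp (-h z))
    (fun z hz => (hder z hz).differentiableAt.differentiableWithinAt) (fun z hz => by
      rw [fderivWithin_of_isOpen Metric.isOpen_ball hz]
      ext
      simp [(hder z hz).deriv]) hz
    (Metric.mem_ball_self one_pos)
  simp only [dslope_same, hf1, hh0, neg_zero, Complex.exp_zero, mul_one] at hconst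
  rw [hfq z]
  congr 1
  calc dslope f 0 z = dslope f 0 z * Complex.exp (-h z) * Complex.exp (h z) := by
        rw [mul_assoc, ← Complex.exp_add]; simp
    _ = Complex.exp (h z) := by rw [hconst, one_mul]

/-- Functions with `Re (z f' / f) > 0` are univalent, and `z f' / f` is analytic. -/
theorem mem_classS_of_re_pos {f : ℂ → ℂ} (hf : f ∈ classA)
    (hpos : ∀ z ∈ disk, 0 < (starQuotient f z).re) :
    f ∈ classS ∧ AnalyticOnNhd ℂ (starQuotient f) disk := by
  obtain ⟨h, h', hd, hh, hfe⟩ := exists_eq_mul_exp hf (fun z hz hz0 hc => by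
    have := hpos z hz
    simp [starQuotient, hz0, hc] at this)
  have hs : ∀ z ∈ disk, starQuotient f z = 1 + z * h' z := fun z hz =>
    starQuotient_eq_of_eqOn hh hfe hz
  refine ⟨⟨hf, ?_⟩, ?_⟩
  · refine (injOn_mul_exp hh fun z hz => ?_).congr fun z hz => (hfe z hz).symm
    rw [← hs z hz]; exact hpos z hz
  · rw [Complex.analyticOnNhd_iff_differentiableOn Metric.isOpen_ball]
    exact ((differentiableOn_const 1).add (differentiableOn_id.mul hd)).congr hs

/-- Every analytic `p` with `p 0 = 1` is the quotient `z f' / f` of some `f ∈ 𝒜`. -/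
theorem exists_starQuotient_eq {p : ℂ → ℂ} (hp : DifferentiableOn ℂ p disk) (hp0 : p 0 = 1) :
    ∃ f ∈ classA, ∀ z ∈ disk, starQuotient f z = p z := by
  have hq : DifferentiableOn ℂ (dslope p 0) disk :=
    (Complex.differentiableOn_dslope (Metric.ball_mem_nhds 0 one_pos)).mpr hp
  -- `h` is a primitive of `(p - 1)/z`, so that `1 + z h' = p`.
  obtain ⟨h, hh0, hh⟩ := hq.isExactOn_ball.with_val_at 0 0
  refine ⟨fun z => z * Complex.exp (h z), ⟨?_, by simp, ?_⟩, fun z hz => ?_⟩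
  · rw [Complex.analyticOnNhd_iff_differentiableOn Metric.isOpen_ball]
    exact fun z hz => (differentiableAt_id.mul
      (hh z hz).differentiableAt.cexp).differentiableWithinAt
  · have := (hasDerivAt_id (0 : ℂ)).mul (hh 0 (Metric.mem_ball_self one_pos)).cexp
    exact this.deriv.trans (by simp [hh0])
  · rw [starQuotient_eq_of_eqOn hh (fun _ _ => rfl) hz]
    have := sub_smul_dslope p 0 z
    rw [sub_zero, smul_eq_mul, hp0] at this
    rw [this]; ring

theorem exists_mem_classS_starQuotient_eq {p : ℂ → ℂ} (hp : DifferentiableOn ℂ p disk)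
    (hp0 : p 0 = 1) (hpos : ∀ z ∈ disk, 0 < (p z).re) :
    ∃ f ∈ classS, ∀ z ∈ disk, starQuotient f z = p z := by
  obtain ⟨f, hf, hfp⟩ := exists_starQuotient_eq hp hp0
  exact ⟨f, (mem_classS_of_re_pos hf fun z hz => by rw [hfp z hz]; exact hpos z hz).1, hfp⟩

/-! ### The cardioid and subordination to `1 + z + z²/2`. -/

theorem norm_sq_eq (v : ℂ) : ‖v‖ ^ 2 = v.re ^ 2 + v.im ^ 2 := by
  rw [Complex.sq_norm, Complex.normSq_apply]; ring

/-- The cardioid region `{(1 + w)² : |w| < 1}` in polar form. -/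
def cardioid : Set ℂ := {v | ‖v‖ ^ 2 < 2 * (‖v‖ + v.re)}

/-- On the nonpositive real axis `‖v‖ + Re v = 0`, which rules out the strict inequality. This makes
the principal root analytic on the cardioid. -/
theorem mem_slitPlane_of_mem_cardioid {v : ℂ} (hv : v ∈ cardioid) : v ∈ Complex.slitPlane := by
  rw [Complex.mem_slitPlane_iff_not_le_zero]
  intro hle
  have h1 := Complex.nonpos_iff.mp hle
  have hv' : ‖v‖ = -v.re := by
    rw [← Complex.abs_re_eq_norm.mpr h1.2, abs_of_nonpos h1.1]
  have : ‖v‖ ^ 2 < 2 * (‖v‖ + v.re) := hv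
  rw [hv'] at this
  nlinarith [sq_nonneg v.re]

/-- Membership in the cardioid in terms of the square root `1 + w`. -/
theorem sq_one_add_mem_cardioid_iff {w : ℂ} (hw : 0 < (1 + w).re) :
    (1 + w) ^ 2 ∈ cardioid ↔ w ∈ disk := by
  have h1 : ‖1 + w‖ ^ 2 = (1 + w).re ^ 2 + (1 + w).im ^ 2 := norm_sq_eq _
  have h2 : ((1 + w) ^ 2).re = (1 + w).re ^ 2 - (1 + w).im ^ 2 := by
    rw [sq, Complex.mul_re]; ring
  have h3 : ‖w‖ ^ 2 = w.re ^ 2 + w.im ^ 2 := norm_sq_eq _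
  have h4 : w ∈ disk ↔ ‖w‖ ^ 2 < 1 := by
    rw [mem_ball_zero_iff, sq_lt_one_iff₀ (norm_nonneg w)]
  rw [h4, h3]
  -- With `s = 1 + w` the condition reads `|s|⁴ < 4 (Re s)²`; as `Re s > 0`, its root `|s|² < 2 Re
  -- s` is `|s - 1| < 1`.
  change ‖(1 + w) ^ 2‖ ^ 2 < 2 * (‖(1 + w) ^ 2‖ + ((1 + w) ^ 2).re) ↔ _
  rw [norm_pow, h1, h2]
  simp only [Complex.add_re, Complex.one_re, Complex.add_im, Complex.one_im, zero_add] at hw ⊢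
  constructor
  · intro h
    have h5 : (1 + w.re) ^ 2 + w.im ^ 2 < 2 * (1 + w.re) := by
      refine lt_of_pow_lt_pow_left₀ 2 (by linarith) ?_
      linarith
    linarith
  · intro h
    have h5 : (1 + w.re) ^ 2 + w.im ^ 2 < 2 * (1 + w.re) := by linarith
    have := pow_lt_pow_left₀ h5 (by positivity) two_ne_zero
    linarith

theorem cpow_half_sq (v : ℂ) : (v ^ (1 / 2 : ℂ)) ^ 2 = v := by
  have := Complex.cpow_nat_inv_pow v two_ne_zero
  rw [one_div]
  exact_mod_cast this

theorem re_cpow_half_pos {v : ℂ} (hv : v ∈ Complex.slitPlane) : 0 < (v ^ (1 / 2 : ℂ)).re := by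
  rw [Complex.cpow_def_of_ne_zero (Complex.slitPlane_ne_zero hv), Complex.exp_re]
  refine mul_pos (Real.exp_pos _) (Real.cos_pos_of_mem_Ioo ?_)
  have h1 := Complex.neg_pi_lt_arg v
  have h2 := lt_of_le_of_ne (Complex.arg_le_pi v) (Complex.mem_slitPlane_iff_arg.mp hv).1
  have h3 : (Complex.log v * (1 / 2)).im = Complex.arg v / 2 := by
    rw [← Complex.log_im]
    simp [Complex.mul_im]
    ring
  rw [h3]
  constructor <;> linarith

theorem re_one_add_pos {w : ℂ} (hw : w ∈ disk) : 0 < (1 + w).re := by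
  have h1 := (abs_lt.mp ((Complex.abs_re_le_norm w).trans_lt (mem_ball_zero_iff.mp hw))).1
  simp only [Complex.add_re, Complex.one_re]
  linarith

theorem two_mul_car_sub_one (w : ℂ) : 2 * (1 + w + w ^ 2 / 2) - 1 = (1 + w) ^ 2 := by ring

/-- The values of `1 + w + w²/2` on the disk form the cardioid region. -/
theorem car_mem_cardioid {w : ℂ} (hw : w ∈ disk) :
    2 * (1 + w + w ^ 2 / 2) - 1 ∈ cardioid := by
  rw [two_mul_car_sub_one]
  exact (sq_one_add_mem_cardioid_iff (re_one_add_pos hw)).mpr hw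

theorem Subordinate.cardioid_mem {g : ℂ → ℂ}
    (hg : Subordinate g fun z => 1 + z + z ^ 2 / 2) {z : ℂ} (hz : z ∈ disk) :
    2 * g z - 1 ∈ cardioid := by
  obtain ⟨w, -, -, hw, hgw⟩ := hg
  rw [hgw z hz]
  exact car_mem_cardioid (hw hz)

/-- The Schwarz function is `√(2p - 1) - 1`, since `2p - 1 = (1 + w)²`. -/
theorem subordinate_car {g p : ℂ → ℂ} (hp : AnalyticOnNhd ℂ p disk) (hgp : ∀ z ∈ disk, g z = p z)
    (h0 : p 0 = 1) (h : ∀ z ∈ disk, 2 * p z - 1 ∈ cardioid) :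
    Subordinate g fun z => 1 + z + z ^ 2 / 2 := by
  have hsq : ∀ z, (1 + ((2 * p z - 1) ^ (1 / 2 : ℂ) - 1)) ^ 2 = 2 * p z - 1 := fun z => by
    rw [add_sub_cancel, cpow_half_sq]
  refine ⟨fun z => (2 * p z - 1) ^ (1 / 2 : ℂ) - 1, ?_, ?_, fun z hz => ?_, fun z hz => ?_⟩
  · intro z hz
    exact (((analyticAt_const.mul (hp z hz)).sub analyticAt_const).cpow analyticAt_const
      (mem_slitPlane_of_mem_cardioid (h z hz))).sub analyticAt_const
  · simp only [h0]
    norm_num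
  · have hs := mem_slitPlane_of_mem_cardioid (h z hz)
    have hre : 0 < (1 + ((2 * p z - 1) ^ (1 / 2 : ℂ) - 1)).re := by
      rw [add_sub_cancel]
      exact re_cpow_half_pos hs
    refine (sq_one_add_mem_cardioid_iff hre).mp ?_
    rw [hsq z]
    exact h z hz
  · have := hsq z
    rw [← two_mul_car_sub_one] at this
    rw [hgp z hz]
    linear_combination (-1 / 2 : ℂ) * this

/-! ### Subordination to Möbius and sector maps. -/

theorem one_add_mul_ne_zero {B : ℝ} (h0 : -1 ≤ B) (h1 : B ≤ 1) {z : ℂ} (hz : z ∈ disk) :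
    1 + (B : ℂ) * z ≠ 0 := by
  intro hc
  have h2 : ‖(B : ℂ) * z‖ = 1 := by
    rw [show (B : ℂ) * z = -1 by linear_combination hc]; simp
  rw [norm_mul, Complex.norm_real, Real.norm_eq_abs] at h2
  have := mul_le_mul_of_nonneg_right (abs_le.mpr ⟨h0, h1⟩) (norm_nonneg z)
  linarith [mem_ball_zero_iff.mp hz]

/-- The values of `(1 + A w) / (1 + B w)` on the disk. -/
theorem norm_sub_one_lt_of_janowski {A B : ℝ} (hB : -1 ≤ B) (hAB : B < A) (hA : B ≤ 1)
    {w : ℂ} (hw : w ∈ disk) :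
    ‖(1 + (A : ℂ) * w) / (1 + (B : ℂ) * w) - 1‖ <
      ‖(A : ℂ) - B * ((1 + (A : ℂ) * w) / (1 + (B : ℂ) * w))‖ := by
  have hw1 := mem_ball_zero_iff.mp hw
  have hne := one_add_mul_ne_zero hB hA hw
  have e1 : (1 + (A : ℂ) * w) / (1 + (B : ℂ) * w) - 1 = ((A : ℂ) - B) / (1 + (B : ℂ) * w) * w := by
    rw [div_sub_one hne]; ring
  have e2 : (A : ℂ) - B * ((1 + (A : ℂ) * w) / (1 + (B : ℂ) * w)) =
      ((A : ℂ) - B) / (1 + (B : ℂ) * w) := by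
    field_simp; ring
  rw [e1, e2, norm_mul]
  refine mul_lt_of_lt_one_right (norm_pos_iff.mpr (div_ne_zero ?_ hne)) hw1
  exact_mod_cast sub_ne_zero.mpr hAB.ne'

/-- Solving `p = (1 + Aw)/(1 + Bw)` gives `w = (p - 1)/(A - Bp)`; the hypothesis says exactly `|w| <
1`. -/
theorem subordinate_janowski {A B : ℝ} (hAB : B < A) {g p : ℂ → ℂ}
    (hp : AnalyticOnNhd ℂ p disk) (hgp : ∀ z ∈ disk, g z = p z) (h0 : p 0 = 1)
    (h : ∀ z ∈ disk, ‖p z - 1‖ < ‖(A : ℂ) - B * p z‖) :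
    Subordinate g fun z => (1 + (A : ℂ) * z) / (1 + (B : ℂ) * z) := by
  have hne : ∀ z ∈ disk, (A : ℂ) - B * p z ≠ 0 := fun z hz =>
    norm_pos_iff.mp ((norm_nonneg _).trans_lt (h z hz))
  have hAB' : (A : ℂ) - B ≠ 0 := by exact_mod_cast sub_ne_zero.mpr hAB.ne'
  refine ⟨fun z => (p z - 1) / ((A : ℂ) - B * p z), ?_, by simp [h0], fun z hz => ?_,
    fun z hz => ?_⟩
  · intro z hz
    exact ((hp z hz).sub analyticAt_const).div
      (analyticAt_const.sub (analyticAt_const.mul (hp z hz))) (hne z hz)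
  · rw [mem_ball_zero_iff, norm_div, div_lt_one (norm_pos_iff.mpr (hne z hz))]
    exact h z hz
  · have hz' := hne z hz
    have e : 1 + (B : ℂ) * ((p z - 1) / ((A : ℂ) - B * p z)) =
        ((A : ℂ) - B) / ((A : ℂ) - B * p z) := by
      field_simp; ring
    have e' : 1 + (A : ℂ) * ((p z - 1) / ((A : ℂ) - B * p z)) =
        ((A : ℂ) - B) / ((A : ℂ) - B * p z) * p z := by
      rw [div_mul_eq_mul_div, eq_div_iff hz', add_mul, mul_assoc, div_mul_cancel₀ _ hz']
      ring
    rw [hgp z hz]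
    simp only
    rw [e, e', mul_div_cancel_left₀ _ (div_ne_zero hAB' hz')]

/-- Squaring exhibits the region as a disk when `|B| < 1` and as a half-plane when `B = -1`. -/
theorem norm_sq_janowski (A B : ℝ) (u : ℂ) :
    ‖u - 1‖ < ‖(A : ℂ) - B * u‖ ↔
      (1 - B ^ 2) * ‖u‖ ^ 2 < 2 * (1 - A * B) * u.re - (1 - A ^ 2) := by
  rw [← sq_lt_sq₀ (norm_nonneg _) (norm_nonneg _)]
  simp only [Complex.sq_norm, Complex.normSq_apply, Complex.sub_re, Complex.sub_im,
    Complex.one_re, Complex.one_im, Complex.mul_re, Complex.mul_im, Complex.ofReal_re,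
    Complex.ofReal_im]
  constructor <;> intro h <;> linarith

theorem re_moebius_pos {w : ℂ} (hw : w ∈ disk) : 0 < ((1 + w) / (1 - w)).re := by
  have hw1 : Complex.normSq w < 1 := by
    rw [← Complex.sq_norm, sq_lt_one_iff₀ (norm_nonneg w)]
    exact mem_ball_zero_iff.mp hw
  have hne : 1 - w ≠ 0 := by
    intro hc
    rw [← sub_eq_zero.mp hc] at hw1
    simp at hw1
  have hpos := Complex.normSq_pos.mpr hne
  rw [Complex.div_re, ← add_div]
  refine div_pos ?_ hpos
  rw [Complex.normSq_apply] at hw1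
  simp only [Complex.add_re, Complex.one_re, Complex.sub_re, Complex.add_im, Complex.one_im,
    Complex.sub_im]
  linarith

theorem log_cpow_ofReal {z : ℂ} (hz : z ≠ 0) {r : ℝ} (h : |r * Complex.arg z| < Real.pi) :
    Complex.log (z ^ (r : ℂ)) = r * Complex.log z := by
  have him : (Complex.log z * r).im = r * Complex.arg z := by
    rw [Complex.im_mul_ofReal, Complex.log_im, mul_comm]
  have h' := abs_lt.mp h
  rw [Complex.cpow_def_of_ne_zero hz, Complex.log_exp (him ▸ h'.1) (him ▸ h'.2.le), mul_comm]

/-- The values of `((1 + w) / (1 - w)) ^ β` on the disk. -/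
theorem abs_arg_lt_of_strong {β : ℝ} (hβ : 0 < β) (hβ1 : β ≤ 1) {w : ℂ} (hw : w ∈ disk) :
    |Complex.arg (((1 + w) / (1 - w)) ^ (β : ℂ))| < β * (Real.pi / 2) := by
  have hre : 0 < ((1 + w) / (1 - w)).re := re_moebius_pos hw
  have hne : (1 + w) / (1 - w) ≠ 0 := by
    intro hc
    simp [hc] at hre
  have h1 := Complex.abs_arg_lt_pi_div_two_iff.mpr (Or.inl hre)
  have h2 : |β * Complex.arg ((1 + w) / (1 - w))| < β * (Real.pi / 2) := by
    rw [abs_mul, abs_of_pos hβ]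
    exact mul_lt_mul_of_pos_left h1 hβ
  have h3 : β * (Real.pi / 2) < Real.pi := by nlinarith [Real.pi_pos]
  rwa [← Complex.log_im, log_cpow_ofReal hne (h2.trans h3), Complex.im_ofReal_mul, Complex.log_im]

/-- With `q = p^(1/β)` the sector becomes the right half-plane, and `w = (q - 1)/(q + 1)` maps that
to the disk. The argument bound keeps all powers on the principal branch. -/
theorem subordinate_strong {β : ℝ} (hβ : 0 < β) (hβ1 : β ≤ 1) {g p : ℂ → ℂ}
    (hp : AnalyticOnNhd ℂ p disk) (hgp : ∀ z ∈ disk, g z = p z) (h0 : p 0 = 1)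
    (hne : ∀ z ∈ disk, p z ≠ 0) (h : ∀ z ∈ disk, |Complex.arg (p z)| < β * (Real.pi / 2)) :
    Subordinate g fun z => ((1 + z) / (1 - z)) ^ (β : ℂ) := by
  have hpi := Real.pi_pos
  have harg : ∀ z ∈ disk, |1 / β * Complex.arg (p z)| < Real.pi / 2 := by
    intro z hz
    rw [abs_mul, abs_of_pos (by positivity), one_div_mul_eq_div, div_lt_iff₀ hβ, mul_comm]
    exact h z hz
  have hlog : ∀ z ∈ disk, Complex.log (p z ^ ((1 / β : ℝ) : ℂ)) =
      ((1 / β : ℝ) : ℂ) * Complex.log (p z) := fun z hz =>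
    log_cpow_ofReal (hne z hz) ((harg z hz).trans (by linarith))
  have hq0 : ∀ z ∈ disk, p z ^ ((1 / β : ℝ) : ℂ) ≠ 0 := fun z hz => by
    rw [Complex.cpow_def_of_ne_zero (hne z hz)]
    exact Complex.exp_ne_zero _
  have hq : ∀ z ∈ disk, 0 < (p z ^ ((1 / β : ℝ) : ℂ)).re := by
    intro z hz
    refine (Complex.abs_arg_lt_pi_div_two_iff.mp ?_).resolve_right (hq0 z hz)
    rw [← Complex.log_im, hlog z hz, Complex.im_ofReal_mul, Complex.log_im]
    exact harg z hz
  have hq1 : ∀ z ∈ disk, p z ^ ((1 / β : ℝ) : ℂ) + 1 ≠ 0 := by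
    intro z hz hc
    have h1 := congrArg Complex.re hc
    simp only [Complex.add_re, Complex.one_re, Complex.zero_re] at h1
    linarith [hq z hz]
  have hslit : ∀ z ∈ disk, p z ∈ Complex.slitPlane := by
    intro z hz
    refine Complex.mem_slitPlane_iff_arg.mpr ⟨fun hc => ?_, hne z hz⟩
    have h1 := h z hz
    rw [hc, abs_of_pos hpi] at h1
    nlinarith
  refine ⟨fun z => (p z ^ ((1 / β : ℝ) : ℂ) - 1) / (p z ^ ((1 / β : ℝ) : ℂ) + 1), ?_, ?_,
    fun z hz => ?_, fun z hz => ?_⟩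
  · intro z hz
    have h1 := (hp z hz).cpow (analyticAt_const (v := ((1 / β : ℝ) : ℂ))) (hslit z hz)
    exact (h1.sub analyticAt_const).div (h1.add analyticAt_const) (hq1 z hz)
  · simp [h0]
  · rw [mem_ball_zero_iff, norm_div, div_lt_one (norm_pos_iff.mpr (hq1 z hz)),
      ← sq_lt_sq₀ (norm_nonneg _) (norm_nonneg _)]
    have h1 := hq z hz
    generalize p z ^ ((1 / β : ℝ) : ℂ) = q at h1
    simp only [Complex.sq_norm, Complex.normSq_apply, Complex.sub_re, Complex.sub_im,
      Complex.one_re, Complex.one_im, Complex.add_re, Complex.add_im]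
    linarith
  · rw [hgp z hz]
    have h1 : (1 + (p z ^ ((1 / β : ℝ) : ℂ) - 1) / (p z ^ ((1 / β : ℝ) : ℂ) + 1)) /
        (1 - (p z ^ ((1 / β : ℝ) : ℂ) - 1) / (p z ^ ((1 / β : ℝ) : ℂ) + 1)) =
        p z ^ ((1 / β : ℝ) : ℂ) := by
      have h2 := hq1 z hz
      rw [one_add_div h2, one_sub_div h2, div_div_div_cancel_right₀ h2]
      rw [show p z ^ ((1 / β : ℝ) : ℂ) + 1 - (p z ^ ((1 / β : ℝ) : ℂ) - 1) = 2 by ring]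
      ring
    simp only
    rw [h1, Complex.cpow_def_of_ne_zero (hq0 z hz), hlog z hz, mul_right_comm,
      ← Complex.ofReal_mul, one_div_mul_cancel hβ.ne', Complex.ofReal_one, one_mul,
      Complex.exp_log (hne z hz)]

/-! ### Inclusions of classes from containments of values. -/

theorem starlikeClass_subset_starCar {φ : ℂ → ℂ} (hφ : AnalyticOnNhd ℂ φ disk) (h0 : φ 0 = 1)
    (h : ∀ w ∈ disk, 2 * φ w - 1 ∈ cardioid) : starlikeClass φ ⊆ starCar := by
  rintro f ⟨hf, w, hw, hw0, hwm, hfw⟩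
  exact ⟨hf, subordinate_car (p := φ ∘ w) (fun z hz => (hφ _ (hwm hz)).comp (hw z hz)) hfw
    (by simp [hw0, h0]) fun z hz => h _ (hwm hz)⟩

theorem car_analytic {w : ℂ → ℂ} (hw : AnalyticOnNhd ℂ w disk) :
    AnalyticOnNhd ℂ (fun z => 1 + w z + w z ^ 2 / 2) disk := fun z hz =>
  (analyticAt_const.add (hw z hz)).add (((hw z hz).pow 2).div_const)

theorem starCar_subset_janowski {A B : ℝ} (hAB : B < A)
    (h : ∀ u : ℂ, 2 * u - 1 ∈ cardioid → ‖u - 1‖ < ‖(A : ℂ) - B * u‖) :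
    starCar ⊆ janowski A B := by
  rintro f ⟨hf, w, hw, hw0, hwm, hfw⟩
  exact ⟨hf, subordinate_janowski hAB (car_analytic hw) hfw (by simp [hw0])
    fun z hz => h _ (car_mem_cardioid (hwm hz))⟩

theorem starCar_subset_stronglyStarlike {β : ℝ} (hβ : 0 < β) (hβ1 : β ≤ 1)
    (h : ∀ u : ℂ, 2 * u - 1 ∈ cardioid → u ≠ 0 ∧ |Complex.arg u| < β * (Real.pi / 2)) :
    starCar ⊆ stronglyStarlike β := by
  rintro f ⟨hf, w, hw, hw0, hwm, hfw⟩
  exact ⟨hf, subordinate_strong hβ hβ1 (car_analytic hw) hfw (by simp [hw0])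
    (fun z hz => (h _ (car_mem_cardioid (hwm hz))).1)
    fun z hz => (h _ (car_mem_cardioid (hwm hz))).2⟩

/-! ### Regions containing the cardioid -/

/-- Keeping `R = ‖2u - 1‖` as a separate real variable turns the later estimates into polynomial
inequalities. -/
theorem re_of_mem_cardioid {u : ℂ} (hu : 2 * u - 1 ∈ cardioid) :
    ∃ R : ℝ, 0 ≤ R ∧ R ^ 2 = (2 * u.re - 1) ^ 2 + 4 * u.im ^ 2 ∧
      R ^ 2 < 2 * (R + (2 * u.re - 1)) := by
  refine ⟨‖2 * u - 1‖, norm_nonneg _, ?_, ?_⟩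
  · rw [norm_sq_eq]; simp; ring
  · simpa [cardioid] using hu

theorem quarter_lt_re {u : ℂ} (hu : 2 * u - 1 ∈ cardioid) : 1 / 4 < u.re := by
  obtain ⟨R, -, -, h⟩ := re_of_mem_cardioid hu
  nlinarith [sq_nonneg (R - 1)]

theorem im_sq_lt {u : ℂ} (hu : 2 * u - 1 ∈ cardioid) : 5 * u.im ^ 2 < 27 * u.re ^ 2 := by
  obtain ⟨R, hR, h1, h2⟩ := re_of_mem_cardioid hu
  have h3 : -1 / 2 ≤ (R ^ 2 - 2 * R) / 2 := by nlinarith [sq_nonneg (R - 1)]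
  have h4 : 0 < (2 * u.re - 1 - (R ^ 2 - 2 * R) / 2) *
      (32 * ((2 * u.re - 1) + (R ^ 2 - 2 * R) / 2) + 54) :=
    mul_pos (by linarith) (by linarith)
  -- Replacing `2 Re u - 1` by its lower bound `(R² - 2R)/2` leaves this quartic; its double root `R
  -- = 3/2` is where the boundary ray is tangent to the cardioid.
  have h5 : 0 ≤ (2 * R - 3) ^ 2 * (2 * R ^ 2 - 2 * R + 3) :=
    mul_nonneg (sq_nonneg _) (by nlinarith [sq_nonneg (R - 1)])
  nlinarith

theorem norm_sq_lt_of_mem_cardioid {u : ℂ} (hu : 2 * u - 1 ∈ cardioid) :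
    2 * (u.re ^ 2 + u.im ^ 2) < (3 + Real.sqrt 5) * u.re := by
  obtain ⟨R, hR, h1, h2⟩ := re_of_mem_cardioid hu
  have h5 : Real.sqrt 5 ^ 2 = 5 := Real.sq_sqrt (by norm_num)
  have h5' : 1 < Real.sqrt 5 := by
    rw [Real.lt_sqrt (by norm_num)]; norm_num
  have h6 : 0 < (1 + Real.sqrt 5) * (2 * (2 * u.re - 1) - (R ^ 2 - 2 * R)) :=
    mul_pos (by linarith) (by linarith)
  -- The double root `R = (3 + √5)/2` marks tangency with the circle `|u|² = 2M Re u`, `M = (3 +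
  -- √5)/4`.
  have h7 : 0 ≤ (Real.sqrt 5 - 1) * (R - (3 + Real.sqrt 5) / 2) ^ 2 :=
    mul_nonneg (by linarith) (sq_nonneg _)
  generalize Real.sqrt 5 = q at *
  have h8 : (q - 1) * (R - (3 + q) / 2) ^ 2 = (q - 1) * R ^ 2 - 2 * (1 + q) * R + 2 * (2 + q) := by
    linear_combination ((5 + q) / 4 - R) * h5
  rw [h8] at h7
  nlinarith

theorem starCar_subset_starlikeOfOrder {α : ℝ} (h : α ≤ 1 / 4) :
    starCar ⊆ starlikeOfOrder α := by
  refine starCar_subset_janowski (by linarith) fun u hu => ?_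
  rw [norm_sq_janowski]
  have := quarter_lt_re hu
  have h2 : 0 < (1 - α) * (u.re - α) := mul_pos (by linarith) (by linarith)
  nlinarith

theorem starCar_subset_janowski_one {M : ℝ} (hM : (3 + Real.sqrt 5) / 4 ≤ M) :
    starCar ⊆ janowski 1 (-(M - 1) / M) := by
  have hM0 : 0 < M := by have := Real.sqrt_nonneg 5; linarith
  have hB : -(M - 1) / M = 1 / M - 1 := by field_simp; ring
  have hM1 : 1 / M < 2 := by
    rw [div_lt_iff₀ hM0]; have := Real.sqrt_nonneg 5; linarith
  have hM2 : 0 < 1 / M := by positivity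
  refine starCar_subset_janowski (by rw [hB]; linarith) fun u hu => ?_
  rw [norm_sq_janowski, hB, norm_sq_eq]
  have h1 := norm_sq_lt_of_mem_cardioid hu
  have h2 := quarter_lt_re hu
  -- For `A = 1`, `B = 1/M - 1` the Janowski region is `|u - M| < M`.
  have h3 : u.re ^ 2 + u.im ^ 2 < 2 * M * u.re := by nlinarith
  have h4 : 1 / M * (u.re ^ 2 + u.im ^ 2) < 2 * u.re := by
    rw [one_div_mul_eq_div, div_lt_iff₀ hM0]; linarith
  have h5 := mul_lt_mul_of_pos_left h4 (show 0 < 2 - 1 / M by linarith)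
  linarith

theorem arg_eq_arctan {u : ℂ} (hu : 0 < u.re) : Complex.arg u = Real.arctan (u.im / u.re) := by
  have h := abs_lt.mp (Complex.abs_arg_lt_pi_div_two_iff.mpr (Or.inl hu))
  rw [← Complex.tan_arg, Real.arctan_tan h.1 h.2]

theorem abs_arg_lt_of_mem_cardioid {u : ℂ} (hu : 2 * u - 1 ∈ cardioid) :
    |Complex.arg u| < Real.arctan (3 * Real.sqrt (3 / 5)) := by
  have hx : 0 < u.re := by linarith [quarter_lt_re hu]
  have h1 : |u.im / u.re| < 3 * Real.sqrt (3 / 5) := by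
    refine abs_lt_of_sq_lt_sq ?_ (by positivity)
    rw [mul_pow, Real.sq_sqrt (by norm_num), div_pow, div_lt_iff₀ (by positivity)]
    linarith [im_sq_lt hu]
  rw [arg_eq_arctan hx, abs_lt, ← Real.arctan_neg]
  exact ⟨Real.arctan_strictMono (abs_lt.mp h1).1, Real.arctan_strictMono (abs_lt.mp h1).2⟩

theorem starCar_subset_stronglyStarlike_of_le {β : ℝ}
    (hβ : 2 / Real.pi * Real.arctan (3 * Real.sqrt (3 / 5)) ≤ β) (hβ1 : β ≤ 1) :
    starCar ⊆ stronglyStarlike β := by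
  have hpi := Real.pi_pos
  have h0 : 0 < Real.arctan (3 * Real.sqrt (3 / 5)) := Real.arctan_pos.mpr (by positivity)
  have h1 : Real.arctan (3 * Real.sqrt (3 / 5)) ≤ β * (Real.pi / 2) := by
    have := mul_le_mul_of_nonneg_right hβ (show 0 ≤ Real.pi / 2 by positivity)
    have h2 : 2 / Real.pi * Real.arctan (3 * Real.sqrt (3 / 5)) * (Real.pi / 2) =
      Real.arctan (3 * Real.sqrt (3 / 5)) := by field_simp
    linarith
  refine starCar_subset_stronglyStarlike (lt_of_lt_of_le (by positivity) hβ) hβ1 fun u hu =>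
    ⟨fun hc => ?_, (abs_arg_lt_of_mem_cardioid hu).trans_le h1⟩
  have := quarter_lt_re hu
  rw [hc, Complex.zero_re] at this
  linarith

/-! ### Regions inside the cardioid -/

/-- This is the right half of the disk with centre `3/2` and radius `5/2`, whose circle passes
through `±2i` and `4`. For `‖v‖ ≤ 2` positivity of `Re v` suffices; beyond that the gap is `(‖v‖ -
2)(4 - ‖v‖)/3`. The region is convex and contains `1`. -/
theorem mem_cardioid_of_norm_sq_lt {v : ℂ} (hv : 0 < v.re) (h : ‖v‖ ^ 2 < 4 + 3 * v.re) :
    v ∈ cardioid := by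
  change ‖v‖ ^ 2 < 2 * (‖v‖ + v.re)
  have h1 := Complex.re_le_norm v
  have h4 : ‖v‖ < 4 := by nlinarith [norm_nonneg v]
  rcases le_or_gt ‖v‖ 2 with h2 | h2
  · nlinarith [norm_nonneg v]
  · nlinarith

theorem mem_cardioid_of_norm_sq_lt_four_mul {v : ℂ} (h : ‖v‖ ^ 2 < 4 * v.re) : v ∈ cardioid := by
  change ‖v‖ ^ 2 < 2 * (‖v‖ + v.re)
  linarith [Complex.re_le_norm v]

theorem mem_cardioid_of_conic {u : ℂ} (h : 5 / 3 * ‖u - 1‖ < u.re) : 2 * u - 1 ∈ cardioid := by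
  change ‖2 * u - 1‖ ^ 2 < 2 * (‖2 * u - 1‖ + (2 * u - 1).re)
  have h1 := Complex.re_le_norm (2 * u - 1)
  have hR := norm_nonneg (2 * u - 1)
  have hR2 := norm_sq_eq (2 * u - 1)
  have h2 : 25 * ((u.re - 1) ^ 2 + u.im ^ 2) < 9 * u.re ^ 2 := by
    have h3 := pow_lt_pow_left₀ h (by positivity) two_ne_zero
    rw [mul_pow, norm_sq_eq] at h3
    simp only [Complex.sub_re, Complex.one_re, Complex.sub_im, Complex.one_im, sub_zero] at h3
    linarith
  have hx : 0 < u.re := lt_of_le_of_lt (by positivity) h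
  have hre : (2 * u - 1).re = 2 * u.re - 1 := by simp
  have him : (2 * u - 1).im = 2 * u.im := by simp
  rw [hre] at h1 hR2 ⊢
  rw [him] at hR2
  generalize ‖2 * u - 1‖ = R at *
  by_contra! hc
  obtain ⟨x, hxu⟩ : ∃ x, x = 2 * u.re - 1 := ⟨_, rfl⟩
  rw [← hxu] at h1 hc
  have h4 : 25 * R ^ 2 < 9 * x ^ 2 + 68 * x - 16 := by rw [hR2, hxu]; linarith
  have h5 : -1 / 2 ≤ (R ^ 2 - 2 * R) / 2 := by nlinarith [sq_nonneg (R - 1)]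
  have h6 : 0 ≤ ((R ^ 2 - 2 * R) / 2 - x) * (9 * ((R ^ 2 - 2 * R) / 2 + x) + 68) :=
    mul_nonneg (by linarith) (by linarith)
  -- Outside the cardioid `x ≤ (R² - 2R)/2`, and the conic inequality then factors so as to force `R
  -- > 4`. With `x ≤ R` instead it gives `(4R - 1)(R - 4) < 0`, a contradiction.
  have h7 : 0 < (R - 4) * (9 * R ^ 3 + 72 * R + 16) := by linarith
  have h8 : 0 < R - 4 := pos_of_mul_pos_left h7 (by positivity)
  have h9 : 0 ≤ (R - x) * (9 * (R + x) + 68) := mul_nonneg (by linarith) (by linarith)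
  nlinarith

theorem kStarlike_subset_starCar {k : ℝ} (hk : 5 / 3 ≤ k) : kStarlike k ⊆ starCar := by
  rintro f ⟨hf, h⟩
  have h1 : ∀ z ∈ disk, 5 / 3 * ‖starQuotient f z - 1‖ < (starQuotient f z).re := fun z hz =>
    lt_of_le_of_lt (mul_le_mul_of_nonneg_right hk (norm_nonneg _)) (h z hz)
  obtain ⟨hS, han⟩ := mem_classS_of_re_pos hf fun z hz =>
    lt_of_le_of_lt (by positivity) (h1 z hz)
  exact ⟨hS, subordinate_car han (fun _ _ => rfl) (by simp [starQuotient])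
    fun z hz => mem_cardioid_of_conic (h1 z hz)⟩

/-- `(1 + a + a²/2)(1 - a + a²/2) = 1 + a⁴/4`. For `a = 1 + Re z` the second factor bounds `cos (Im
z)` from below on the disk. -/
theorem one_le_exp_mul {a : ℝ} (ha : 0 ≤ a) : 1 ≤ Real.exp a * (1 - a + a ^ 2 / 2) := by
  have h1 := Real.quadratic_le_exp_of_nonneg ha
  have h2 : 0 ≤ 1 - a + a ^ 2 / 2 := by nlinarith [sq_nonneg (a - 1)]
  have h3 := mul_le_mul_of_nonneg_right h1 h2
  nlinarith [sq_nonneg (a ^ 2)]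

theorem exp_le_chord {a : ℝ} (h1 : 1 ≤ a) (h2 : a ≤ 2) :
    Real.exp a ≤ (2 - a) * Real.exp 1 + (a - 1) * Real.exp 1 ^ 2 := by
  have h := convexOn_exp.2 (Set.mem_univ 1) (Set.mem_univ 2)
    (show 0 ≤ 2 - a by linarith) (show 0 ≤ a - 1 by linarith) (by ring)
  have h3 : Real.exp 2 = Real.exp 1 ^ 2 := by rw [← Real.exp_nat_mul]; norm_num
  simp only [smul_eq_mul, h3] at h
  rwa [show (2 - a) * 1 + (a - 1) * 2 = a by ring] at h

theorem exp_sq_add_one_le {a : ℝ} (h0 : 0 ≤ a) (h2 : a ≤ 2) :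
    Real.exp a ^ 2 + 1 ≤ 4 * (Real.exp 1 - 1) ^ 2 - 3 * (Real.exp 1 - 1) +
      (3 * (Real.exp 1 - 1) + 2) * (Real.exp a * (1 - a + a ^ 2 / 2)) := by
  have he1 := Real.exp_one_gt_d9
  have he2 := Real.exp_one_lt_d9
  have hE := Real.one_le_exp h0
  have hc : 6.65 ≤ 4 * (Real.exp 1 - 1) ^ 2 - 3 * (Real.exp 1 - 1) := by nlinarith
  have hK : 0 < 1 - a + a ^ 2 / 2 := by nlinarith [sq_nonneg (a - 1)]
  have hm : 7.15 * (Real.exp a * (1 - a + a ^ 2 / 2)) ≤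
      (3 * (Real.exp 1 - 1) + 2) * (Real.exp a * (1 - a + a ^ 2 / 2)) :=
    mul_le_mul_of_nonneg_right (by linarith) (by positivity)
  rcases le_total a 1 with ha | ha
  · have h3 := Real.exp_le_exp.mpr ha
    have h4 : 1 / 2 ≤ 1 - a + a ^ 2 / 2 := by nlinarith [sq_nonneg (a - 1)]
    have h5 : Real.exp a * (1 / 2) ≤ Real.exp a * (1 - a + a ^ 2 / 2) :=
      mul_le_mul_of_nonneg_left h4 (by positivity)
    nlinarith
  · have h3 := exp_le_chord ha h2
    have he3 : Real.exp 1 ^ 2 ≤ 7.3891 := by nlinarith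
    have h4 : Real.exp a ≤ (2 - a) * 2.7183 + (a - 1) * 7.3891 := by
      refine h3.trans (add_le_add ?_ ?_)
      · exact mul_le_mul_of_nonneg_left (by linarith) (by linarith)
      · exact mul_le_mul_of_nonneg_left he3 (by linarith)
    -- The chord bound reduces this to a quadratic in `a` with minimum near `1.653`. Multiplied by
    -- `exp a`, it leaves `0.76 exp a + 1 ≤ 6.65`, which holds up to `a = 2`.
    have h5 : Real.exp a - 0.76 ≤ 7.15 * (1 - a + a ^ 2 / 2) := by
      nlinarith [sq_nonneg (a - 1.653)]
    have h6 := mul_le_mul_of_nonneg_left h5 (show 0 ≤ Real.exp a by positivity)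
    nlinarith

theorem exp_one_add_bounds {z : ℂ} (hz : z ∈ disk) :
    1 < (Complex.exp (1 + z)).re ∧ ‖Complex.exp (1 + z) - 1‖ ^ 2 <
      4 * (Real.exp 1 - 1) ^ 2 + 3 * (Real.exp 1 - 1) * ((Complex.exp (1 + z)).re - 1) := by
  have hz1 : z.re ^ 2 + z.im ^ 2 < 1 := by
    rw [← norm_sq_eq, sq_lt_one_iff₀ (norm_nonneg z)]
    exact mem_ball_zero_iff.mp hz
  obtain ⟨a, ha⟩ : ∃ a, a = 1 + z.re := ⟨_, rfl⟩
  have ha0 : 0 ≤ a := by nlinarith [sq_nonneg z.im]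
  have ha2 : a ≤ 2 := by nlinarith [sq_nonneg z.im]
  have hre : (Complex.exp (1 + z)).re = Real.exp a * Real.cos z.im := by
    simp [Complex.exp_re, ha]
  have him : (Complex.exp (1 + z)).im = Real.exp a * Real.sin z.im := by
    simp [Complex.exp_im, ha]
  have hcos : 1 - a + a ^ 2 / 2 < Real.cos z.im := by
    have := Real.one_sub_sq_div_two_le_cos (x := z.im)
    rw [ha]; linarith
  have hEC := mul_lt_mul_of_pos_left hcos (Real.exp_pos a)
  have hd : 0 < 3 * (Real.exp 1 - 1) + 2 := by
    have := Real.exp_one_gt_d9; linarith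
  have h1 := one_le_exp_mul ha0
  have h2 := exp_sq_add_one_le ha0 ha2
  have h3 := mul_lt_mul_of_pos_left hEC hd
  refine ⟨by rw [hre]; linarith, ?_⟩
  rw [norm_sq_eq]
  simp only [Complex.sub_re, Complex.one_re, Complex.sub_im, Complex.one_im, sub_zero, hre, him]
  have h4 : (Real.exp a * Real.cos z.im) ^ 2 + (Real.exp a * Real.sin z.im) ^ 2 =
      Real.exp a ^ 2 := by
    linear_combination Real.exp a ^ 2 * Real.sin_sq_add_cos_sq z.im
  linarith

theorem exp_mem_cardioid {α : ℝ} (h0 : (Real.exp 1 - 2) / (2 * (Real.exp 1 - 1)) ≤ α)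
    (h1 : α < 1) {z : ℂ} (hz : z ∈ disk) :
    2 * ((α : ℂ) + (1 - (α : ℂ)) * Complex.exp z) - 1 ∈ cardioid := by
  have he := Real.exp_one_gt_d9
  obtain ⟨d, hd⟩ : ∃ d, d = Real.exp 1 - 1 := ⟨_, rfl⟩
  have hd0 : 0 < d := by linarith
  -- With `v = (e^(1+z) - 1)/(e - 1)` the value is `1 + τ(v - 1)`, and `τ = 1` exactly at the
  -- critical `α`. For `τ ≤ 1` convexity of the half-disk around `1` suffices.
  obtain ⟨τ, hτ⟩ : ∃ τ, τ = 2 * (1 - α) * d / Real.exp 1 := ⟨_, rfl⟩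
  have hτ0 : 0 < τ := by
    have : 0 < 1 - α := by linarith
    rw [hτ]
    positivity
  have hτ1 : τ ≤ 1 := by
    rw [← hd, div_le_iff₀ (by positivity)] at h0
    rw [hτ, div_le_one (by positivity)]
    linarith
  obtain ⟨b1, b2⟩ := exp_one_add_bounds hz
  rw [← hd] at b2
  obtain ⟨v, hv⟩ : ∃ v, v = (Complex.exp (1 + z) - 1) / (d : ℂ) := ⟨_, rfl⟩
  have hdc : (d : ℂ) ≠ 0 := by exact_mod_cast hd0.ne'
  have hvd : Complex.exp (1 + z) - 1 = (d : ℂ) * v := by rw [hv]; field_simp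
  have hre : (Complex.exp (1 + z)).re - 1 = d * v.re := by
    have := congrArg Complex.re hvd
    simpa using this
  have hv1 : 0 < v.re := pos_of_mul_pos_right (by linarith) hd0.le
  have hv2 : ‖v‖ ^ 2 < 4 + 3 * v.re := by
    rw [hvd, hre, norm_mul, mul_pow, Complex.norm_real, Real.norm_eq_abs, sq_abs] at b2
    refine lt_of_mul_lt_mul_left (a := d ^ 2) ?_ (by positivity)
    linarith
  have hE : (Real.exp 1 : ℂ) ≠ 0 := by exact_mod_cast (Real.exp_pos 1).ne'
  have hval : 2 * ((α : ℂ) + (1 - (α : ℂ)) * Complex.exp z) - 1 = 1 + (τ : ℂ) * (v - 1) := by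
    have h2 : (d : ℂ) = Real.exp 1 - 1 := by rw [hd]; push_cast; ring
    have h3 : Complex.exp (1 + z) = Real.exp 1 * Complex.exp z := by
      rw [Complex.exp_add, Complex.ofReal_exp, Complex.ofReal_one]
    have h4 : (τ : ℂ) = 2 * (1 - α) * d / Real.exp 1 := by rw [hτ]; push_cast; ring
    have h5 : (d : ℂ) * (v - 1) = Real.exp 1 * (Complex.exp z - 1) := by
      rw [mul_sub, ← hvd, h3, h2]; ring
    have h6 : (τ : ℂ) * (v - 1) = 2 * (1 - α) * (d * (v - 1)) / Real.exp 1 := by rw [h4]; ring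
    rw [h6, h5]
    field_simp
    ring
  rw [hval]
  rw [norm_sq_eq] at hv2
  apply mem_cardioid_of_norm_sq_lt
  · simp
    nlinarith
  · rw [norm_sq_eq]
    simp
    have h7 : 0 ≤ τ * (1 - τ) * ((v.re - 1) ^ 2 + v.im ^ 2) := by
      have : 0 ≤ 1 - τ := by linarith
      positivity
    have h8 := mul_lt_mul_of_pos_left hv2 hτ0
    nlinarith

theorem starExp_subset_starCar {α : ℝ} (h0 : (Real.exp 1 - 2) / (2 * (Real.exp 1 - 1)) ≤ α)
    (h1 : α < 1) : starExp α ⊆ starCar :=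
  starlikeClass_subset_starCar (fun _ _ => by fun_prop) (by simp)
    fun _ hz => exp_mem_cardioid h0 h1 hz

theorem one_add_mul_mem_slitPlane {c : ℝ} (h0 : 0 ≤ c) (h1 : c ≤ 1) {z : ℂ} (hz : z ∈ disk) :
    1 + (c : ℂ) * z ∈ Complex.slitPlane := by
  have h := (abs_lt.mp ((Complex.abs_re_le_norm z).trans_lt (mem_ball_zero_iff.mp hz))).1
  refine Or.inl ?_
  simp only [Complex.add_re, Complex.one_re, Complex.re_ofReal_mul]
  rcases h0.eq_or_lt with rfl | h2
  · simp
  · nlinarith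

theorem starLemniscate_subset_starCar {α : ℝ} (h0 : 1 / 2 ≤ α) (h1 : α < 1) :
    starLemniscate α ⊆ starCar := by
  have hs : ∀ z ∈ disk, 1 + z ∈ Complex.slitPlane := fun z hz => Or.inl (re_one_add_pos hz)
  refine starlikeClass_subset_starCar (fun z hz => ?_) (by simp) fun z hz => ?_
  · exact analyticAt_const.add (analyticAt_const.mul
      ((analyticAt_const.add analyticAt_id).cpow analyticAt_const (hs z hz)))
  · have h2 := re_cpow_half_pos (hs z hz)
    have h3 := congrArg norm (cpow_half_sq (1 + z))
    have h4 : ‖1 + z‖ < 2 := by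
      have := norm_add_le (1 : ℂ) z
      rw [norm_one] at this
      linarith [mem_ball_zero_iff.mp hz]
    rw [norm_pow] at h3
    generalize (1 + z) ^ (1 / 2 : ℂ) = s at *
    have h5 : ‖s‖ ≤ 3 / 2 := by nlinarith [norm_nonneg s]
    have hval : 2 * ((α : ℂ) + (1 - (α : ℂ)) * s) - 1 =
        ((2 * α - 1 : ℝ) : ℂ) + ((2 * (1 - α) : ℝ) : ℂ) * s := by push_cast; ring
    have hre : 0 < (2 * ((α : ℂ) + (1 - (α : ℂ)) * s) - 1).re := by
      rw [hval, Complex.add_re, Complex.re_ofReal_mul, Complex.ofReal_re]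
      have := mul_pos (show 0 < 2 * (1 - α) by linarith) h2
      linarith
    refine mem_cardioid_of_norm_sq_lt hre ?_
    -- For `α ≥ 1/2` this is a convex combination of `1` and `s`.
    have hn : ‖2 * ((α : ℂ) + (1 - (α : ℂ)) * s) - 1‖ ≤ 2 := by
      rw [hval]
      refine (norm_add_le _ _).trans ?_
      rw [norm_mul, Complex.norm_real, Complex.norm_real, Real.norm_eq_abs, Real.norm_eq_abs,
        abs_of_nonneg (by linarith), abs_of_nonneg (by linarith)]
      nlinarith
    nlinarith [norm_nonneg (2 * ((α : ℂ) + (1 - (α : ℂ)) * s) - 1)]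

theorem starCassini_subset_starCar {c : ℝ} (h0 : 0 < c) (h1 : c ≤ 3 / 4) :
    starCassini c ⊆ starCar := by
  have hs : ∀ z ∈ disk, 1 + (c : ℂ) * z ∈ Complex.slitPlane := fun z hz =>
    one_add_mul_mem_slitPlane h0.le (by linarith) hz
  refine starlikeClass_subset_starCar (fun z hz => ?_) (by simp) fun z hz => ?_
  · exact (analyticAt_const.add (analyticAt_const.mul analyticAt_id)).cpow analyticAt_const (hs z hz)
  · have h2 := re_cpow_half_pos (hs z hz)
    have h3 := cpow_half_sq (1 + (c : ℂ) * z)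
    have h4 : ‖(c : ℂ) * z‖ < 3 / 4 := by
      rw [norm_mul, Complex.norm_real, Real.norm_eq_abs, abs_of_pos h0]
      nlinarith [mem_ball_zero_iff.mp hz, norm_nonneg z]
    generalize (1 + (c : ℂ) * z) ^ (1 / 2 : ℂ) = s at *
    have h5 : s ^ 2 - 1 = c * z := by rw [h3]; ring
    rw [← h5] at h4
    have h6 := abs_lt.mp ((Complex.abs_re_le_norm _).trans_lt h4)
    have h7 : ‖s‖ ^ 2 < 7 / 4 := by
      have := norm_add_le (s ^ 2 - 1) 1
      rw [sub_add_cancel, norm_one, norm_pow] at this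
      linarith
    rw [norm_sq_eq] at h7
    have h8 : (s ^ 2 - 1).re = s.re ^ 2 - s.im ^ 2 - 1 := by
      simp [sq, Complex.mul_re]
    rw [h8] at h6
    have h9 : 1 / 2 < s.re := by nlinarith [sq_nonneg s.im]
    refine mem_cardioid_of_norm_sq_lt ?_ ?_
    · simp; linarith
    · rw [norm_sq_eq]
      simp
      rcases le_total s.re 1 with h10 | h10 <;> nlinarith

theorem janowski_subset_starCar {A B : ℝ} (hB : -1 < B) (hAB : B < A) (hA : A ≤ 1)
    (h : (2 * (1 - A * B) ≤ 3 * (1 - B ^ 2) ∧ 2 * A ≤ 1 + B) ∨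
      (3 * (1 - B ^ 2) ≤ 2 * (1 - A * B) ∧ 2 * A ≤ 3 + 5 * B)) :
    janowski A B ⊆ starCar := by
  refine starlikeClass_subset_starCar (fun z hz => ?_) (by simp) fun z hz => ?_
  · exact (analyticAt_const.add (analyticAt_const.mul analyticAt_id)).div
      (analyticAt_const.add (analyticAt_const.mul analyticAt_id))
      (one_add_mul_ne_zero hB.le (by linarith) hz)
  · have h1 := (norm_sq_janowski A B _).mp
      (norm_sub_one_lt_of_janowski hB.le hAB (by linarith) hz)
    generalize (1 + (A : ℂ) * z) / (1 + (B : ℂ) * z) = u at *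
    -- The target is the disk `|u - 3/2| < 1`. In case (a) the Janowski disk has centre at most
    -- `3/2` and left end `(1 - A)/(1 - B) ≥ 1/2`; in case (b) its centre is at least `3/2` and its
    -- right end `(1 + A)/(1 + B) ≤ 5/2`.
    apply mem_cardioid_of_norm_sq_lt_four_mul
    rw [norm_sq_eq] at h1 ⊢
    simp
    have hn : 0 < 1 - B ^ 2 := by nlinarith
    have h2 : ((1 - B) * u.re - (1 - A)) * ((1 + B) * u.re - (1 + A)) < 0 := by
      nlinarith [mul_nonneg hn.le (sq_nonneg u.im)]
    have h3 : 1 - A < (1 - B) * u.re := by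
      by_contra! hc
      have : (1 + B) * u.re ≤ 1 + A := by nlinarith
      nlinarith
    have h4 : (1 + B) * u.re < 1 + A := by
      by_contra! hc
      nlinarith
    refine lt_of_mul_lt_mul_left (a := 1 - B ^ 2) ?_ hn.le
    rcases h with ⟨h5, h6⟩ | ⟨h5, h6⟩
    · have hx : 1 / 2 < u.re := by nlinarith
      have h7 : 0 ≤ (12 * (1 - B ^ 2) - 8 * (1 - A * B)) * (u.re - 1 / 2) :=
        mul_nonneg (by linarith) (by linarith)
      have h8 : 0 ≤ (1 - (2 * A - B)) * (1 + (2 * A - B)) :=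
        mul_nonneg (by linarith) (by linarith)
      nlinarith
    · have hx : u.re < 5 / 2 := by nlinarith
      have h7 : 0 ≤ (8 * (1 - A * B) - 12 * (1 - B ^ 2)) * (5 / 2 - u.re) :=
        mul_nonneg (by linarith) (by linarith)
      have h8 : 0 ≤ (3 - (2 * A - 5 * B)) * (3 + (2 * A - 5 * B)) :=
        mul_nonneg (by linarith) (by linarith)
      nlinarith

/-! ### Sharpness by extremal functions. -/

/-- The class `𝒮*(φ)` contains an extremal function with `z f' / f = φ`. -/
theorem exists_mem_starlikeClass {φ : ℂ → ℂ} (hφ : AnalyticOnNhd ℂ φ disk) (h0 : φ 0 = 1)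
    (hpos : ∀ z ∈ disk, 0 < (φ z).re) :
    ∃ f ∈ starlikeClass φ, ∀ z ∈ disk, starQuotient f z = φ z := by
  obtain ⟨f, hf, hfφ⟩ := exists_mem_classS_starQuotient_eq hφ.differentiableOn h0 hpos
  exact ⟨f, ⟨hf, id, analyticOnNhd_id, rfl, Set.mapsTo_id _, hfφ⟩, hfφ⟩

/-- If `𝒮*_car ⊆ 𝒮*(ψ)` then the cardioid is covered by the values of `ψ`. -/
theorem exists_eq_of_starCar_subset {ψ : ℂ → ℂ} (h : starCar ⊆ starlikeClass ψ) {z : ℂ}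
    (hz : z ∈ disk) : ∃ w ∈ disk, 1 + z + z ^ 2 / 2 = ψ w := by
  obtain ⟨f, hf, hfφ⟩ := exists_mem_starlikeClass (car_analytic analyticOnNhd_id) (by simp)
    (fun z hz => (by norm_num : (0 : ℝ) < 1 / 4).trans (quarter_lt_re (car_mem_cardioid hz)))
  obtain ⟨-, w, -, -, hw, hfw⟩ := h hf
  exact ⟨w z, hw hz, by rw [← hfw z hz, hfφ z hz]⟩

/-- If `𝒮*(φ) ⊆ 𝒮*_car` then the values of `φ` lie in the cardioid. -/
theorem mem_cardioid_of_subset_starCar {φ : ℂ → ℂ} (hφ : AnalyticOnNhd ℂ φ disk) (h0 : φ 0 = 1)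
    (hpos : ∀ z ∈ disk, 0 < (φ z).re) (h : starlikeClass φ ⊆ starCar) {z : ℂ} (hz : z ∈ disk) :
    2 * φ z - 1 ∈ cardioid := by
  obtain ⟨f, hf, hfφ⟩ := exists_mem_starlikeClass hφ h0 hpos
  rw [← hfφ z hz]
  exact (h hf).2.cardioid_mem hz

/-- Touching points lie on the unit circle, so strict inequalities on the disk are carried there by
continuity. -/
theorem nonneg_of_forall_disk {F : ℂ → ℝ} (hF : Continuous F) (h : ∀ z ∈ disk, 0 < F z) {z : ℂ}
    (hz : z.re ^ 2 + z.im ^ 2 = 1) : 0 ≤ F z := by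
  have hz' : z ∈ closure disk := by
    rw [closure_ball 0 one_ne_zero, mem_closedBall_zero_iff, ← sq_le_one_iff₀ (norm_nonneg z),
      norm_sq_eq, hz]
  exact closure_minimal (fun w hw => (h w hw).le) (isClosed_le continuous_const hF) hz'

theorem car_re (z : ℂ) : (1 + z + z ^ 2 / 2).re = 1 + z.re + (z.re ^ 2 - z.im ^ 2) / 2 := by
  simp [sq, Complex.mul_re]

theorem car_im (z : ℂ) : (1 + z + z ^ 2 / 2).im = z.im + z.re * z.im := by
  simp [sq, Complex.mul_im]; ring

theorem not_starCar_subset_starlikeOfOrder {α : ℝ} (h : 1 / 4 < α) (h1 : α < 1) :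
    ¬ starCar ⊆ starlikeOfOrder α := by
  intro hsub
  have hF : ∀ z ∈ disk, 0 < (1 + z + z ^ 2 / 2).re - α := by
    intro z hz
    obtain ⟨w, hw, hzw⟩ := exists_eq_of_starCar_subset hsub hz
    have h2 := (norm_sq_janowski _ _ _).mp (norm_sub_one_lt_of_janowski (A := 1 - 2 * α) (B := -1)
      le_rfl (by linarith) (by norm_num) hw)
    rw [← hzw] at h2
    have h3 : 0 < (1 - α) * ((1 + z + z ^ 2 / 2).re - α) := by linarith
    exact pos_of_mul_pos_right h3 (by linarith)
  have h3 : Real.sqrt 3 ^ 2 = 3 := Real.sq_sqrt (by norm_num)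
  have := nonneg_of_forall_disk (F := fun z => (1 + z + z ^ 2 / 2).re - α) (by fun_prop) hF
    -- `e^(2πi/3)`, where the real part attains its minimum `1/4`.
    (z := ⟨-1 / 2, Real.sqrt 3 / 2⟩) (by simp only; linarith)
  simp only [car_re] at this
  linarith

theorem not_starCar_subset_janowski_one {M : ℝ} (h : 1 / 2 < M) (h1 : M < (3 + Real.sqrt 5) / 4) :
    ¬ starCar ⊆ janowski 1 (-(M - 1) / M) := by
  intro hsub
  have hM0 : 0 < M := by linarith
  have hB : -(M - 1) / M = 1 / M - 1 := by field_simp; ring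
  have hM1 : 1 / M < 2 := by rw [div_lt_iff₀ hM0]; linarith
  have hM2 : 0 < 1 / M := by positivity
  have hF : ∀ z ∈ disk, 0 < 2 * M * (1 + z + z ^ 2 / 2).re - ‖1 + z + z ^ 2 / 2‖ ^ 2 := by
    intro z hz
    obtain ⟨w, hw, hzw⟩ := exists_eq_of_starCar_subset hsub hz
    have h2 := (norm_sq_janowski _ _ _).mp (norm_sub_one_lt_of_janowski (A := 1)
      (B := -(M - 1) / M) (by rw [hB]; linarith) (by rw [hB]; linarith) (by rw [hB]; linarith) hw)
    rw [← hzw, hB] at h2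
    generalize 1 + z + z ^ 2 / 2 = u at h2
    have h3 : 1 / M * ‖u‖ ^ 2 < 2 * u.re := by
      refine lt_of_mul_lt_mul_left (a := 2 - 1 / M) ?_ (by linarith)
      linarith
    rw [one_div_mul_eq_div, div_lt_iff₀ hM0] at h3
    linarith
  have h5 : Real.sqrt 5 ^ 2 = 5 := Real.sq_sqrt (by norm_num)
  have h5' : 0 < Real.sqrt 5 := by positivity
  have hy : Real.sqrt ((5 + Real.sqrt 5) / 8) ^ 2 = (5 + Real.sqrt 5) / 8 :=
    Real.sq_sqrt (by positivity)
  have := nonneg_of_forall_disk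
    (F := fun z => 2 * M * (1 + z + z ^ 2 / 2).re - ‖1 + z + z ^ 2 / 2‖ ^ 2) (by fun_prop) hF
    -- `e^(2πi/5)`: here `|1 + z|² = (3 + √5)/2`, the tangency value of `R`.
    (z := ⟨(Real.sqrt 5 - 1) / 4, Real.sqrt ((5 + Real.sqrt 5) / 8)⟩) (by
      simp only
      rw [hy]
      linear_combination h5 / 16)
  simp only [norm_sq_eq, car_re, car_im] at this
  generalize Real.sqrt ((5 + Real.sqrt 5) / 8) = y at *
  generalize Real.sqrt 5 = q at *
  have e1 : 1 + (q - 1) / 4 + (((q - 1) / 4) ^ 2 - y ^ 2) / 2 = (5 + q) / 8 := by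
    linear_combination h5 / 32 - hy / 2
  have e2 : (y + (q - 1) / 4 * y) ^ 2 = (5 + q) / 8 * ((q + 3) / 4) ^ 2 := by
    linear_combination ((q + 3) / 4) ^ 2 * hy
  rw [e1, e2] at this
  have e3 : ((5 + q) / 8) ^ 2 + (5 + q) / 8 * ((q + 3) / 4) ^ 2 = (3 + q) / 2 * ((5 + q) / 8) := by
    linear_combination ((5 + q) / 128) * h5
  rw [e3] at this
  nlinarith

theorem not_starCar_subset_stronglyStarlike {β : ℝ} (h0 : 0 < β)
    (h : β < 2 / Real.pi * Real.arctan (3 * Real.sqrt (3 / 5))) :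
    ¬ starCar ⊆ stronglyStarlike β := by
  intro hsub
  have hpi := Real.pi_pos
  have h1 : β * (Real.pi / 2) < Real.arctan (3 * Real.sqrt (3 / 5)) := by
    have := mul_lt_mul_of_pos_right h (show 0 < Real.pi / 2 by positivity)
    have h2 : 2 / Real.pi * Real.arctan (3 * Real.sqrt (3 / 5)) * (Real.pi / 2) =
      Real.arctan (3 * Real.sqrt (3 / 5)) := by field_simp
    linarith
  have h2 := Real.arctan_lt_pi_div_two (3 * Real.sqrt (3 / 5))
  have hβ1 : β ≤ 1 := by nlinarith
  have hlow : -(Real.pi / 2) < β * (Real.pi / 2) := by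
    have : 0 < β * (Real.pi / 2) := by positivity
    linarith
  have hT : Real.tan (β * (Real.pi / 2)) < 3 * Real.sqrt (3 / 5) := by
    rw [← Real.arctan_strictMono.lt_iff_lt, Real.arctan_tan hlow (by linarith)]
    exact h1
  have hF : ∀ z ∈ disk, 0 < Real.tan (β * (Real.pi / 2)) * (1 + z + z ^ 2 / 2).re -
      (1 + z + z ^ 2 / 2).im := by
    intro z hz
    obtain ⟨w, hw, hzw⟩ := exists_eq_of_starCar_subset hsub hz
    have h3 := abs_arg_lt_of_strong h0 hβ1 hw
    rw [← hzw] at h3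
    have hx : 0 < (1 + z + z ^ 2 / 2).re := by linarith [quarter_lt_re (car_mem_cardioid hz)]
    rw [arg_eq_arctan hx] at h3
    have h4 := (abs_lt.mp h3).2
    rw [← Real.arctan_tan hlow (by linarith), Real.arctan_strictMono.lt_iff_lt, div_lt_iff₀ hx] at h4
    linarith
  have h15 : Real.sqrt 15 ^ 2 = 15 := Real.sq_sqrt (by norm_num)
  have := nonneg_of_forall_disk
    (F := fun z => Real.tan (β * (Real.pi / 2)) * (1 + z + z ^ 2 / 2).re -
      (1 + z + z ^ 2 / 2).im) (by fun_prop) hF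
    -- Here `|1 + z|² = 3/2`, the tangency value of `R`.
    (z := ⟨-1 / 4, Real.sqrt 15 / 4⟩) (by simp only; linarith)
  simp only [car_re, car_im] at this
  have h6 : Real.sqrt (3 / 5) = Real.sqrt 15 / 5 := by
    rw [Real.sqrt_eq_iff_eq_sq (by norm_num) (by positivity), div_pow, h15]; norm_num
  rw [h6] at hT
  have h7 : 1 + -1 / 4 + ((-1 / 4) ^ 2 - (Real.sqrt 15 / 4) ^ 2) / 2 = 5 / 16 := by
    linear_combination -h15 / 32
  rw [h7] at this
  linarith

theorem ofReal_mem_cardioid_pos {x : ℝ} (h : (x : ℂ) ∈ cardioid) : 0 < x := by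
  by_contra! hx
  have h1 : ‖(x : ℂ)‖ ^ 2 < 2 * (‖(x : ℂ)‖ + (x : ℂ).re) := h
  rw [Complex.norm_real, Real.norm_eq_abs, abs_of_nonpos hx, Complex.ofReal_re] at h1
  nlinarith [sq_nonneg x]

theorem ofReal_mem_disk {x : ℝ} (h : -1 < x) (h1 : x < 1) : (x : ℂ) ∈ disk := by
  rw [mem_ball_zero_iff, Complex.norm_real, Real.norm_eq_abs]
  exact abs_lt.mpr ⟨h, h1⟩

theorem ofReal_sq_cpow_half {t : ℝ} (ht : 0 ≤ t) : ((t ^ 2 : ℝ) : ℂ) ^ (1 / 2 : ℂ) = t := by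
  have h : (1 / 2 : ℂ) = ((1 / 2 : ℝ) : ℂ) := by push_cast; rfl
  rw [h, ← Complex.ofReal_cpow (sq_nonneg t), ← Real.sqrt_eq_rpow, Real.sqrt_sq ht]

theorem not_starExp_subset_starCar {α : ℝ} (h0 : 0 ≤ α)
    (h : α < (Real.exp 1 - 2) / (2 * (Real.exp 1 - 1))) : ¬ starExp α ⊆ starCar := by
  intro hsub
  have he := Real.exp_one_gt_d9
  rw [lt_div_iff₀ (by linarith)] at h
  have hα : α < 1 / 2 := by nlinarith
  have hr : 0 < (1 / 2 - α) / (1 - α) := div_pos (by linarith) (by linarith)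
  -- At this point `φ = 1/2`, so `2φ - 1` is the cusp `0`.
  have hz : ((Real.log ((1 / 2 - α) / (1 - α)) : ℝ) : ℂ) ∈ disk := by
    refine ofReal_mem_disk ?_ ?_
    · rw [Real.lt_log_iff_exp_lt hr, Real.exp_neg, lt_div_iff₀ (by linarith),
        inv_mul_lt_iff₀ (Real.exp_pos 1)]
      linarith
    · rw [Real.log_lt_iff_lt_exp hr, div_lt_iff₀ (by linarith)]
      nlinarith
  have hpos : ∀ z ∈ disk, 0 < ((α : ℂ) + (1 - (α : ℂ)) * Complex.exp z).re := by
    intro z hz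
    have h1 := abs_lt.mp ((Complex.abs_im_le_norm z).trans_lt (mem_ball_zero_iff.mp hz))
    have h2 : 0 < (Complex.exp z).re := by
      rw [Complex.exp_re]
      refine mul_pos (Real.exp_pos _) (Real.cos_pos_of_mem_Ioo ?_)
      have := Real.pi_gt_three
      constructor <;> linarith
    have h3 : (α : ℂ) + (1 - (α : ℂ)) * Complex.exp z =
        (α : ℂ) + ((1 - α : ℝ) : ℂ) * Complex.exp z := by push_cast; ring
    rw [h3, Complex.add_re, Complex.re_ofReal_mul, Complex.ofReal_re]
    have := mul_pos (show 0 < 1 - α by linarith) h2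
    linarith
  have h1 := mem_cardioid_of_subset_starCar (fun _ _ => by fun_prop) (by simp) hpos hsub hz
  have h2 : 2 * ((α : ℂ) + (1 - (α : ℂ)) *
      Complex.exp ((Real.log ((1 / 2 - α) / (1 - α)) : ℝ) : ℂ)) - 1 = ((0 : ℝ) : ℂ) := by
    have h3 : (1 - α) * ((1 / 2 - α) / (1 - α)) = 1 / 2 - α :=
      mul_div_cancel₀ _ (by linarith)
    rw [← Complex.ofReal_exp, Real.exp_log hr]
    have h4 : 2 * (α + (1 - α) * ((1 / 2 - α) / (1 - α))) - 1 = 0 := by rw [h3]; ring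
    exact_mod_cast h4
  rw [h2] at h1
  exact lt_irrefl _ (ofReal_mem_cardioid_pos h1)

theorem not_starLemniscate_subset_starCar {α : ℝ} (h0 : 0 ≤ α) (h : α < 1 / 2) :
    ¬ starLemniscate α ⊆ starCar := by
  intro hsub
  have hs : ∀ z ∈ disk, 1 + z ∈ Complex.slitPlane := fun z hz => Or.inl (re_one_add_pos hz)
  have hpos : ∀ z ∈ disk, 0 < ((α : ℂ) + (1 - (α : ℂ)) * (1 + z) ^ (1 / 2 : ℂ)).re := by
    intro z hz
    have h3 : (α : ℂ) + (1 - (α : ℂ)) * (1 + z) ^ (1 / 2 : ℂ) =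
        (α : ℂ) + ((1 - α : ℝ) : ℂ) * (1 + z) ^ (1 / 2 : ℂ) := by push_cast; ring
    rw [h3, Complex.add_re, Complex.re_ofReal_mul, Complex.ofReal_re]
    have := mul_pos (show 0 < 1 - α by linarith) (re_cpow_half_pos (hs z hz))
    linarith
  -- The root of `1 + z` is `(1 - 2α)/2`, which makes `2φ - 1 = α(2α - 1) ≤ 0`.
  have hz : ((((1 - 2 * α) / 2) ^ 2 - 1 : ℝ) : ℂ) ∈ disk :=
    ofReal_mem_disk (by nlinarith) (by nlinarith)
  have h1 := mem_cardioid_of_subset_starCar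
    (φ := fun z => (α : ℂ) + (1 - (α : ℂ)) * (1 + z) ^ (1 / 2 : ℂ))
    (fun z hz => analyticAt_const.add (analyticAt_const.mul
      ((analyticAt_const.add analyticAt_id).cpow analyticAt_const (hs z hz)))) (by simp) hpos
      hsub hz
  have h2 : 1 + ((((1 - 2 * α) / 2) ^ 2 - 1 : ℝ) : ℂ) = ((((1 - 2 * α) / 2) ^ 2 : ℝ) : ℂ) := by
    push_cast; ring
  rw [h2, ofReal_sq_cpow_half (by linarith)] at h1
  have h3 : 2 * ((α : ℂ) + (1 - (α : ℂ)) * (((1 - 2 * α) / 2 : ℝ) : ℂ)) - 1 =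
      ((α * (2 * α - 1) : ℝ) : ℂ) := by push_cast; ring
  rw [h3] at h1
  nlinarith [ofReal_mem_cardioid_pos h1]

theorem not_starCassini_subset_starCar {c : ℝ} (h0 : 3 / 4 < c) (h : c ≤ 1) :
    ¬ starCassini c ⊆ starCar := by
  intro hsub
  have hc : 0 < c := by linarith
  have hs : ∀ z ∈ disk, 1 + (c : ℂ) * z ∈ Complex.slitPlane := fun z hz =>
    one_add_mul_mem_slitPlane hc.le h hz
  have hz : ((-(3 / 4) / c : ℝ) : ℂ) ∈ disk := by
    refine ofReal_mem_disk ?_ ?_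
    · rw [lt_div_iff₀ hc]; linarith
    · rw [div_lt_iff₀ hc]; linarith
  have h1 := mem_cardioid_of_subset_starCar (φ := fun z => (1 + (c : ℂ) * z) ^ (1 / 2 : ℂ))
    (fun z hz => (analyticAt_const.add (analyticAt_const.mul analyticAt_id)).cpow
      analyticAt_const (hs z hz))
    (by simp) (fun z hz => re_cpow_half_pos (hs z hz)) hsub hz
  have h2 : 1 + (c : ℂ) * ((-(3 / 4) / c : ℝ) : ℂ) = (((1 / 2) ^ 2 : ℝ) : ℂ) := by
    have : 1 + c * (-(3 / 4) / c) = (1 / 2) ^ 2 := by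
      rw [mul_div_cancel₀ _ hc.ne']; norm_num
    exact_mod_cast this
  rw [h2, ofReal_sq_cpow_half (by norm_num)] at h1
  have h3 : 2 * ((1 / 2 : ℝ) : ℂ) - 1 = ((0 : ℝ) : ℂ) := by push_cast; norm_num
  rw [h3] at h1
  exact lt_irrefl _ (ofReal_mem_cardioid_pos h1)

/-! ### Sharpness for `k`-starlike functions by thin lens maps. -/

/-- The map `t ↦ t / (1 + t)` sends a thin sector around the positive axis close to `[0, 1]`. -/
theorem norm_div_one_add_sub_le {ρ θ : ℝ} (hρ : 0 < ρ) (hθ : |θ| < Real.pi / 2) :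
    1 + ρ * Complex.exp (Complex.I * θ) ≠ 0 ∧
      ‖ρ * Complex.exp (Complex.I * θ) / (1 + ρ * Complex.exp (Complex.I * θ)) -
        ((ρ / (1 + ρ) : ℝ) : ℂ)‖ ≤ |θ| := by
  have hcos : 0 < Real.cos θ := Real.cos_pos_of_mem_Ioo ⟨(abs_lt.mp hθ).1, (abs_lt.mp hθ).2⟩
  have hre : 1 ≤ (1 + ρ * Complex.exp (Complex.I * θ)).re := by
    have h1 : (Complex.exp (Complex.I * θ)).re = Real.cos θ := by
      rw [mul_comm, Complex.exp_ofReal_mul_I_re]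
    rw [Complex.add_re, Complex.re_ofReal_mul, h1, Complex.one_re]
    nlinarith
  have hn : 1 ≤ ‖1 + ρ * Complex.exp (Complex.I * θ)‖ := hre.trans (Complex.re_le_norm _)
  have hne : 1 + ρ * Complex.exp (Complex.I * θ) ≠ 0 := norm_pos_iff.mp (by linarith)
  refine ⟨hne, ?_⟩
  have hρ1 : (1 + ρ : ℂ) ≠ 0 := by exact_mod_cast (show (1 + ρ : ℝ) ≠ 0 by positivity)
  have e : ρ * Complex.exp (Complex.I * θ) / (1 + ρ * Complex.exp (Complex.I * θ)) -
      ((ρ / (1 + ρ) : ℝ) : ℂ) = ((ρ / (1 + ρ) : ℝ) : ℂ) * (Complex.exp (Complex.I * θ) - 1) /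
        (1 + ρ * Complex.exp (Complex.I * θ)) := by
    push_cast
    rw [div_sub_div _ _ hne hρ1, div_mul_eq_mul_div, div_div,
      div_eq_div_iff (mul_ne_zero hne hρ1) (mul_ne_zero hρ1 hne)]
    ring
  have h2 : ‖Complex.exp (Complex.I * θ) - 1‖ ≤ |θ| := Real.norm_exp_I_mul_ofReal_sub_one_le
  have h3 : ρ / (1 + ρ) ≤ 1 := by rw [div_le_one (by positivity)]; linarith
  have h4 : 0 ≤ ρ / (1 + ρ) := by positivity
  rw [e, norm_div, norm_mul, Complex.norm_real, Real.norm_eq_abs, abs_of_nonneg h4]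
  calc ρ / (1 + ρ) * ‖Complex.exp (Complex.I * θ) - 1‖ / ‖1 + ρ * Complex.exp (Complex.I * θ)‖
      ≤ ρ / (1 + ρ) * ‖Complex.exp (Complex.I * θ) - 1‖ := div_le_self (by positivity) hn
    _ ≤ 1 * |θ| := mul_le_mul h3 h2 (norm_nonneg _) zero_le_one
    _ = |θ| := one_mul _

/-- A holomorphic map of the disk into a thin neighbourhood of a real segment around `1`. -/
theorem exists_lens {x₀ x x₁ ε : ℝ} (h0 : x₀ < 1) (hx : 1 < x) (h1 : x < x₁) (hε : 0 < ε) :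
    ∃ p : ℂ → ℂ, DifferentiableOn ℂ p disk ∧ p 0 = 1 ∧ (∃ z ∈ disk, p z = x) ∧
      ∀ z ∈ disk, ∃ s ∈ Set.Icc x₀ x₁, ‖p z - s‖ < ε := by
  have hpi := Real.pi_pos
  have hL : 0 < x₁ - x₀ := by linarith
  obtain ⟨γ, hγ0, hγ1, hγ⟩ : ∃ γ : ℝ, 0 < γ ∧ γ ≤ 1 ∧ γ * ((x₁ - x₀) * Real.pi) ≤ ε := by
    refine ⟨min 1 (ε / ((x₁ - x₀) * Real.pi)), lt_min one_pos (by positivity), min_le_left _ _, ?_⟩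
    calc _ ≤ ε / ((x₁ - x₀) * Real.pi) * ((x₁ - x₀) * Real.pi) :=
          mul_le_mul_of_nonneg_right (min_le_right _ _) (by positivity)
      _ = ε := div_mul_cancel₀ _ (by positivity)
  -- With `t = c((1 + z)/(1 - z))^γ`, this `c` makes `x₀ + (x₁ - x₀) t/(1 + t)` equal `1` at `z =
  -- 0`; a small `γ` makes the sector thin.
  obtain ⟨c, hc⟩ : ∃ c, c = (1 - x₀) / (x₁ - 1) := ⟨_, rfl⟩
  have hc0 : 0 < c := by rw [hc]; exact div_pos (by linarith) (by linarith)
  let t : ℂ → ℂ := fun z => c * Complex.exp (γ * Complex.log ((1 + z) / (1 - z)))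
  have hpolar : ∀ z ∈ disk, ∃ ρ θ : ℝ, 0 < ρ ∧ |θ| < γ * (Real.pi / 2) ∧
      t z = ρ * Complex.exp (Complex.I * θ) := by
    intro z hz
    refine ⟨c * Real.exp (γ * Real.log ‖(1 + z) / (1 - z)‖), γ * Complex.arg ((1 + z) / (1 - z)),
      by positivity, ?_, ?_⟩
    · rw [abs_mul, abs_of_pos hγ0]
      exact mul_lt_mul_of_pos_left
        (Complex.abs_arg_lt_pi_div_two_iff.mpr (Or.inl (re_moebius_pos hz))) hγ0
    · simp only [t, Complex.log]
      push_cast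
      rw [mul_assoc, ← Complex.exp_add]
      congr 2
      ring
  have hpolar' : ∀ z ∈ disk, ∃ ρ θ : ℝ, 0 < ρ ∧ |θ| < γ * (Real.pi / 2) ∧
      t z = ρ * Complex.exp (Complex.I * θ) ∧ |θ| < Real.pi / 2 := by
    intro z hz
    obtain ⟨ρ, θ, a, b, d⟩ := hpolar z hz
    exact ⟨ρ, θ, a, b, d, by nlinarith⟩
  have hne : ∀ z ∈ disk, 1 + t z ≠ 0 := by
    intro z hz
    obtain ⟨ρ, θ, a, b, d, e⟩ := hpolar' z hz
    rw [d]
    exact (norm_div_one_add_sub_le a e).1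
  have hval : ∀ (z : ℂ) (y : ℝ), y < x₁ → t z = (((y - x₀) / (x₁ - y) : ℝ) : ℂ) →
      (x₀ : ℂ) + (x₁ - x₀) * (t z / (1 + t z)) = y := by
    intro z y hy hty
    have hy' : x₁ - y ≠ 0 := by linarith
    have h2 : x₀ + (x₁ - x₀) * ((y - x₀) / (x₁ - y) / (1 + (y - x₀) / (x₁ - y))) = y := by
      rw [one_add_div hy', div_div_div_cancel_right₀ hy', show x₁ - y + (y - x₀) = x₁ - x₀ by ring,
        mul_div_cancel₀ _ hL.ne']
      ring
    rw [hty]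
    exact_mod_cast h2
  refine ⟨fun z => (x₀ : ℂ) + (x₁ - x₀) * (t z / (1 + t z)), ?_, ?_, ?_, ?_⟩
  · have ht : DifferentiableOn ℂ t disk := by
      intro z hz
      have h1z : 1 - z ≠ 0 := by
        intro hc
        have := re_moebius_pos hz
        rw [hc, div_zero] at this
        simp at this
      refine DifferentiableAt.differentiableWithinAt ?_
      refine (differentiableAt_const _).mul (DifferentiableAt.cexp ((differentiableAt_const _).mul
        (DifferentiableAt.clog (DifferentiableAt.div (by fun_prop) (by fun_prop) h1z)
          (Or.inl (re_moebius_pos hz)))))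
    exact (differentiableOn_const _).add ((differentiableOn_const _).mul
      (ht.div ((differentiableOn_const _).add ht) hne))
  · have := hval 0 1 (by linarith) (by simp [t, hc])
    simpa using this
  · have hr : 0 < (x - x₀) / (x₁ - x) / c :=
      div_pos (div_pos (by linarith) (by linarith)) hc0
    obtain ⟨ζ, hζ⟩ : ∃ ζ, ζ = Real.exp (Real.log ((x - x₀) / (x₁ - x) / c) / γ) := ⟨_, rfl⟩
    have hζ0 : 0 < ζ := by rw [hζ]; positivity
    refine ⟨(((ζ - 1) / (ζ + 1) : ℝ) : ℂ), ofReal_mem_disk ?_ ?_, hval _ x h1 ?_⟩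
    · rw [lt_div_iff₀ (by positivity)]; linarith
    · rw [div_lt_iff₀ (by positivity)]; linarith
    · have h2 : (1 + (((ζ - 1) / (ζ + 1) : ℝ) : ℂ)) / (1 - (((ζ - 1) / (ζ + 1) : ℝ) : ℂ)) =
          (ζ : ℂ) := by
        have h3 : (1 + (ζ - 1) / (ζ + 1)) / (1 - (ζ - 1) / (ζ + 1)) = ζ := by
          have : ζ + 1 ≠ 0 := by positivity
          rw [one_add_div this, one_sub_div this, div_div_div_cancel_right₀ this]
          ring
        exact_mod_cast h3
      simp only [t]
      rw [h2, ← Complex.ofReal_log hζ0.le, hζ, Real.log_exp, ← Complex.ofReal_mul,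
        mul_div_cancel₀ _ hγ0.ne', ← Complex.ofReal_exp, Real.exp_log hr, ← Complex.ofReal_mul,
        mul_div_cancel₀ _ hc0.ne']
  · intro z hz
    obtain ⟨ρ, θ, a, b, d, e⟩ := hpolar' z hz
    have h3 : ρ / (1 + ρ) ≤ 1 := by rw [div_le_one (by positivity)]; linarith
    have h4 : 0 ≤ ρ / (1 + ρ) := by positivity
    refine ⟨x₀ + (x₁ - x₀) * (ρ / (1 + ρ)), ⟨?_, ?_⟩, ?_⟩
    · have := mul_nonneg hL.le h4; linarith
    · have := mul_le_mul_of_nonneg_left h3 hL.le; linarith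
    · have h5 := (norm_div_one_add_sub_le a e).2
      rw [← d] at h5
      have h6 : (x₀ : ℂ) + (x₁ - x₀) * (t z / (1 + t z)) -
          ((x₀ + (x₁ - x₀) * (ρ / (1 + ρ)) : ℝ) : ℂ) =
          ((x₁ - x₀ : ℝ) : ℂ) * (t z / (1 + t z) - ((ρ / (1 + ρ) : ℝ) : ℂ)) := by
        push_cast; ring
      simp only
      rw [h6, norm_mul, Complex.norm_real, Real.norm_eq_abs, abs_of_pos hL]
      calc _ ≤ (x₁ - x₀) * |θ| := mul_le_mul_of_nonneg_left h5 hL.le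
        _ < (x₁ - x₀) * (γ * (Real.pi / 2)) := mul_lt_mul_of_pos_left b hL
        _ ≤ ε := by
          have : 0 < γ * ((x₁ - x₀) * Real.pi) := by positivity
          linarith

theorem not_kStarlike_subset_starCar {k : ℝ} (h0 : 0 ≤ k) (h : k < 5 / 3) :
    ¬ kStarlike k ⊆ starCar := by
  intro hsub
  -- At `s = 5/2` the margin `s - k|s - 1|` is `8η`, so some of it survives both lengthening the
  -- segment by `η` and thickening it by `η/16`. The value `5/2` corresponds to the excluded vertex
  -- `4`.
  obtain ⟨η, hη⟩ : ∃ η, η = (5 - 3 * k) / 16 := ⟨_, rfl⟩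
  have hη0 : 0 < η := by rw [hη]; linarith
  have hη1 : η ≤ 5 / 16 := by rw [hη]; linarith
  obtain ⟨p, hp, hp0, ⟨z, hz, hpz⟩, hps⟩ := exists_lens (x₀ := 1 - η) (x := 5 / 2)
    (x₁ := 5 / 2 + η) (ε := η / 16) (by linarith) (by norm_num) (by linarith) (by linarith)
  obtain ⟨f, hf, hfp⟩ := exists_starQuotient_eq hp hp0
  have hk : f ∈ kStarlike k := by
    refine ⟨hf, fun w hw => ?_⟩
    rw [hfp w hw]
    obtain ⟨s, ⟨hs0, hs1⟩, hs⟩ := hps w hw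
    have h1 : ‖p w - 1‖ ≤ |s - 1| + η / 16 := by
      have h2 : p w - 1 = (p w - s) + ((s - 1 : ℝ) : ℂ) := by push_cast; ring
      have h3 := norm_add_le (p w - s) ((s - 1 : ℝ) : ℂ)
      rw [← h2, Complex.norm_real, Real.norm_eq_abs] at h3
      linarith
    have h2 : s - η / 16 ≤ (p w).re := by
      have := (abs_lt.mp ((Complex.abs_re_le_norm (p w - s)).trans_lt hs)).1
      simp only [Complex.sub_re, Complex.ofReal_re] at this
      linarith
    have h3 : k * ‖p w - 1‖ ≤ k * (|s - 1| + η / 16) := mul_le_mul_of_nonneg_left h1 h0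
    have h4 : η / 2 ≤ s - k * |s - 1| := by
      rcases le_total s 1 with hs2 | hs2
      · rw [abs_of_nonpos (by linarith)]
        nlinarith
      · rw [abs_of_nonneg (by linarith)]
        rcases le_total k 1 with hk1 | hk1
        · nlinarith
        · have := mul_le_mul_of_nonneg_left hs1 (show 0 ≤ k - 1 by linarith)
          nlinarith
    nlinarith
  have h1 := (hsub hk).2.cardioid_mem hz
  rw [hfp z hz, hpz] at h1
  have h2 : 2 * ((5 / 2 : ℝ) : ℂ) - 1 = ((4 : ℝ) : ℂ) := by push_cast; norm_num
  rw [h2] at h1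
  have h3 : ‖((4 : ℝ) : ℂ)‖ ^ 2 < 2 * (‖((4 : ℝ) : ℂ)‖ + ((4 : ℝ) : ℂ).re) := h1
  rw [Complex.norm_real, Complex.ofReal_re] at h3
  norm_num at h3

end CardioidStarlike

theorem theorem3p1 :
    -- (i)
    ((∀ α : ℝ, 0 ≤ α → α ≤ 1 / 4 →
        CardioidStarlike.starCar ⊆ CardioidStarlike.starlikeOfOrder α) ∧
      (∀ α : ℝ, 1 / 4 < α → α < 1 →
        ¬ CardioidStarlike.starCar ⊆ CardioidStarlike.starlikeOfOrder α)) ∧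
    -- (ii)
    ((∀ β : ℝ, 2 / Real.pi * Real.arctan (3 * Real.sqrt (3 / 5)) ≤ β → β ≤ 1 →
        CardioidStarlike.starCar ⊆ CardioidStarlike.stronglyStarlike β) ∧
      (∀ β : ℝ, 0 < β → β < 2 / Real.pi * Real.arctan (3 * Real.sqrt (3 / 5)) →
        ¬ CardioidStarlike.starCar ⊆ CardioidStarlike.stronglyStarlike β)) ∧
    -- (iii)
    ((∀ k : ℝ, 5 / 3 ≤ k → CardioidStarlike.kStarlike k ⊆ CardioidStarlike.starCar) ∧
      (∀ k : ℝ, 0 ≤ k → k < 5 / 3 →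
        ¬ CardioidStarlike.kStarlike k ⊆ CardioidStarlike.starCar)) ∧
    -- (iv)
    ((∀ α : ℝ, (Real.exp 1 - 2) / (2 * (Real.exp 1 - 1)) ≤ α → α < 1 →
        CardioidStarlike.starExp α ⊆ CardioidStarlike.starCar) ∧
      (∀ α : ℝ, 0 ≤ α → α < (Real.exp 1 - 2) / (2 * (Real.exp 1 - 1)) →
        ¬ CardioidStarlike.starExp α ⊆ CardioidStarlike.starCar)) ∧
    -- (v)
    ((∀ α : ℝ, 1 / 2 ≤ α → α < 1 →
        CardioidStarlike.starLemniscate α ⊆ CardioidStarlike.starCar) ∧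
      (∀ α : ℝ, 0 ≤ α → α < 1 / 2 →
        ¬ CardioidStarlike.starLemniscate α ⊆ CardioidStarlike.starCar)) ∧
    -- (vi)
    ((∀ c : ℝ, 0 < c → c ≤ 3 / 4 →
        CardioidStarlike.starCassini c ⊆ CardioidStarlike.starCar) ∧
      (∀ c : ℝ, 3 / 4 < c → c ≤ 1 →
        ¬ CardioidStarlike.starCassini c ⊆ CardioidStarlike.starCar)) ∧
    -- (vii)
    (∀ A B : ℝ, -1 < B → B < A → A ≤ 1 →
      ((1 - B ^ 2 < 2 * (1 - A * B) ∧ 2 * (1 - A * B) ≤ 3 * (1 - B ^ 2) ∧ 2 * A ≤ 1 + B) ∨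
        (3 * (1 - B ^ 2) ≤ 2 * (1 - A * B) ∧ 2 * (1 - A * B) < 5 * (1 - B ^ 2) ∧
          2 * A ≤ 3 + 5 * B)) →
      CardioidStarlike.janowski A B ⊆ CardioidStarlike.starCar) ∧
    -- (viii)
    ((∀ M : ℝ, (3 + Real.sqrt 5) / 4 ≤ M →
        CardioidStarlike.starCar ⊆ CardioidStarlike.janowski 1 (-(M - 1) / M)) ∧
      (∀ M : ℝ, 1 / 2 < M → M < (3 + Real.sqrt 5) / 4 →
        ¬ CardioidStarlike.starCar ⊆ CardioidStarlike.janowski 1 (-(M - 1) / M))) := by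
  exact ⟨⟨fun _ _ h =>
      CardioidStarlike.starCar_subset_starlikeOfOrder h,
      fun _ h h1 =>
      CardioidStarlike.not_starCar_subset_starlikeOfOrder h h1⟩,
    ⟨fun _ h h1 =>
      CardioidStarlike.starCar_subset_stronglyStarlike_of_le h h1,
      fun _ h h1 =>
      CardioidStarlike.not_starCar_subset_stronglyStarlike h h1⟩,
    ⟨fun _ h =>
      CardioidStarlike.kStarlike_subset_starCar h, fun _ h h1 =>
      CardioidStarlike.not_kStarlike_subset_starCar h h1⟩,
    ⟨fun _ h h1 =>
      CardioidStarlike.starExp_subset_starCar h h1, fun _ h h1 =>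
      CardioidStarlike.not_starExp_subset_starCar h h1⟩,
    ⟨fun _ h h1 =>
      CardioidStarlike.starLemniscate_subset_starCar h h1,
      fun _ h h1 =>
      CardioidStarlike.not_starLemniscate_subset_starCar h h1⟩,
    ⟨fun _ h h1 =>
      CardioidStarlike.starCassini_subset_starCar h h1,
      fun _ h h1 =>
      CardioidStarlike.not_starCassini_subset_starCar h h1⟩,
    fun _ _ hB hAB hA h =>
      CardioidStarlike.janowski_subset_starCar hB hAB hA
      (h.imp (fun h => ⟨h.2.1, h.2.2⟩) fun h => ⟨h.1, h.2.2⟩),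
    ⟨fun _ h =>
      CardioidStarlike.starCar_subset_janowski_one h,
      fun _ h h1 =>
      CardioidStarlike.not_starCar_subset_janowski_one h h1⟩⟩
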